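/- Let $\mathbb N=\{1,2,3,\dots\}$. All linear equations are of the form $A:\ a_1x_1+\dots+a_kx_k=0$ with $a_1,\dots,a_k\in\mathbb Z\setminus\{0\}$; identify $A$ with the $1\times k$ matrix $(a_1,\dots,a_k)$. A solution is *$k$-distinct* if $x_1,\dots,x_k$ are pairwise distinct. The equation $A$ is *irredundant* if it has a $k$-distinct solution in $\mathbb N$, and *partition regular* if for every colouring of $\mathbb N$ with finitely many colours there is a monochromatic solution (not necessarily $k$-distinct) of $A$ in $\mathbb N$. For $\overline W\subseteq\{1,\dots,k\}$ let $A_{\overline W}$ be the matrix obtained from $A$ by keeping only the columns in $\overline W$ (with rank $0$ if $\overline W=\emptyset$). For linear equations $A$, $B$ on at least three variables, with $A$ on $k$ variables, put $$m(A)=\max_{\substack{W\,\dot\cup\,\overline W=\{1,\dots,k\}\\ |W|\ge 2}}\frac{|W|-1}{|W|-1+\operatorname{rank}(A_{\overline W})-\operatorname{rank}(A)},\qquad m(A,B)=\max_{\substack{W\,\dot\cup\,\overline W=\{1,\dots,k\}\\ |W|\ge 2}}\frac{|W|}{|W|-1+\operatorname{rank}(A_{\overline W})-\operatorname{rank}(A)+1/m(B)}.$$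 Given linear equations $A_1,\dots,A_r$, where $A_i$ has $k_i$ variables, a set $S$ of integers is *$(A_1,\dots,A_r)$-Rado* if for every colouring of $S$ with colours $1,\dots,r$ there is some $i$ and a $k_i$-distinct solution of $A_i$ in $S$ all of whose entries have colour $i$. Let $[n]_p$ denote the random subset of $\{1,\dots,n\}$ in which each element is included independently with probability $p$. **Corollary.** Let $r\ge 2$ and let $A_1,\dots,A_r$ be irredundant partition regular homogeneous linear equations, each on at least $3$ variables, with $m(A_1)\ge m(A_2)\ge\dots\ge m(A_r)$. Then there exists a constant $c>0$ such that for every sequence $p=p(n)\in[0,1]$ with $p(n)<c\,n^{-1/m(A_1,A_2)}$ for all sufficiently large $n$, $$\lim_{n\to\infty}\mathbb P\big[[n]_{p}\text{ is }(A_1,\dots,A_r)\text{-Rado}\big]=0.$$ -/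

import Mathlib

noncomputable section

namespace RandomRado

/-- The rank (over `ℚ`) of the matrix obtained from `A` by keeping only the columns outside `W`,
i.e. the columns indexed by the complement of `W`. -/
def rankCompl {l k : ℕ} (A : Matrix (Fin l) (Fin k) ℤ) (W : Finset (Fin k)) : ℕ :=
  ((A.map (Int.cast : ℤ → ℚ)).submatrix id (Subtype.val : {j : Fin k // j ∉ W} → Fin k)).rank

/-- The rank of an integer matrix over `ℚ`. -/
def rankQ {l k : ℕ} (A : Matrix (Fin l) (Fin k) ℤ) : ℕ :=
  (A.map (Int.cast : ℤ → ℚ)).rank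

/-- `m(A)`: the maximum, over all sets `W` of at least two columns, of
`(|W| - 1) / (|W| - 1 + rank (A restricted to the complement of W) - rank A)`.
The supremum is over a finite set, which is nonempty as soon as `k ≥ 2`. -/
def matrixM {l k : ℕ} (A : Matrix (Fin l) (Fin k) ℤ) : ℝ :=
  ⨆ W : {W : Finset (Fin k) // 2 ≤ W.card},
    ((W.1.card : ℝ) - 1) / ((W.1.card : ℝ) - 1 + (rankCompl A W.1 : ℝ) - (rankQ A : ℝ))

/-- `m(A, B)`: the maximum, over all sets `W` of at least two columns of `A`, of
`|W| / (|W| - 1 + rank (A restricted to the complement of W) - rank A + 1 / m(B))`. -/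
def matrixM₂ {l k l' k' : ℕ} (A : Matrix (Fin l) (Fin k) ℤ) (B : Matrix (Fin l') (Fin k') ℤ) : ℝ :=
  ⨆ W : {W : Finset (Fin k) // 2 ≤ W.card},
    (W.1.card : ℝ) / ((W.1.card : ℝ) - 1 + (rankCompl A W.1 : ℝ) - (rankQ A : ℝ) + 1 / matrixM B)

/-- A linear equation `a₁ x₁ + ⋯ + aₖ xₖ = b` with integer constant term and nonzero integer
coefficients. The number `k` of variables is `length`. -/
structure LinearEquation where
  length : ℕ
  coeff : Fin length → ℤ
  coeff_ne_zero : ∀ j, coeff j ≠ 0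
  const : ℤ

namespace LinearEquation

/-- The `1 × k` matrix of coefficients of a linear equation. -/
def underlyingMatrix (A : LinearEquation) : Matrix (Fin 1) (Fin A.length) ℤ :=
  Matrix.of fun _ j => A.coeff j

/-- `x` solves the equation. -/
def IsSolution (A : LinearEquation) (x : Fin A.length → ℤ) : Prop :=
  ∑ j, A.coeff j * x j = A.const

def IsHomogeneous (A : LinearEquation) : Prop :=
  A.const = 0

/-- There is a solution in pairwise distinct positive integers. -/
def Irredundant (A : LinearEquation) : Prop :=
  ∃ x : Fin A.length → ℤ, (∀ j, 0 < x j) ∧ Function.Injective x ∧ A.IsSolution x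

/-- Every colouring of the positive integers with finitely many colours has a monochromatic
(not necessarily distinct) solution. -/
def PartitionRegular (A : LinearEquation) : Prop :=
  ∀ (q : ℕ) (χ : {z : ℤ // 0 < z} → Fin q),
    ∃ x : Fin A.length → {z : ℤ // 0 < z},
      A.IsSolution (fun j => (x j : ℤ)) ∧ ∃ c : Fin q, ∀ j, χ (x j) = c

/-- `m(A)` for a linear equation. -/
def m (A : LinearEquation) : ℝ :=
  matrixM A.underlyingMatrix

/-- `m(A, B)` for two linear equations. -/
def m₂ (A B : LinearEquation) : ℝ :=
  matrixM₂ A.underlyingMatrix B.underlyingMatrix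

end LinearEquation

/-- The set `S` of integers is `(A₁, …, A_r)`-Rado: for every `r`-colouring of `S` there are a
colour `i` and a solution of `A_i` in pairwise distinct elements of `S`, all of colour `i`. -/
def IsRado {r : ℕ} (A : Fin r → LinearEquation) (S : Set ℤ) : Prop :=
  ∀ χ : S → Fin r, ∃ i : Fin r, ∃ x : Fin (A i).length → S,
    Function.Injective x ∧ (A i).IsSolution (fun j => (x j : ℤ)) ∧ ∀ j, χ (x j) = i

/-- The law of the random set `[n]_p`: each element of `{1, …, n}` is included independently
with probability `p`. -/
def randomSubset (n : ℕ) (p : unitInterval) : MeasureTheory.Measure (Set ℤ) :=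
  ProbabilityTheory.setBernoulli (Set.Icc (1 : ℤ) (n : ℤ)) p

end RandomRado

end

set_option linter.unusedSectionVars false

/-! Two colours suffice: if a set is Rado for all the equations, then every 2-colouring of it has a
solution of A₁ in one prescribed colour or of A₂ in the other. Let k ≤ l be their numbers of
variables. Injective solutions are the edges, of sizes k and l, of a hypergraph, and each edge
carries its coefficient vector. A configuration with v vertices whose vectors have rank ρ has at
most n^(v-ρ) copies in {1, …, n}. Since 1/m(A₁,A₂) = 1 - l/(k(l-1)), the expected number of copies
present is at most c^v n^(w/(k(l-1))), where w = l v - k(l-1) ρ is the `weight`.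

The deterministic half is `dense_or_long`. In a minimal unavoidable family, every edge is crossed at
each of its vertices by an edge of the other type that meets it nowhere else (`exists_cross_edge`).
Explore the family along such crossings. Either new edges attach at single vertices, without
increasing the weight, which stays at most k; or the exploration closes up and loses weight, and
boundedly many further edges make it negative. For k = l one edge is added at a time
(`path_extend`), and the only obstruction is a loose triangle with k = 3. For k < l the unit is a
cluster: an l-edge together with a k-edge through each of its new vertices (`cluster_extend`). The
result is a configuration of negative weight or a chain of length about L and weight at most k.

The probabilistic half is a first-moment bound over labelled codes. New edges of a chain attach to
one of the most recent l edges, so there are only O(B^j) codes of chains of length j, with B = 2l³,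
and c = 1/(eB) absorbs this count. With L = ⌈log n⌉, long chains contribute a polylogarithm times
e^(-L) n^(1/2), and dense configurations a polylogarithm times a negative power of n
(`measure_unavoidable_le`, `tendsto_first_moment_bound`). -/

namespace RandomRado

/-! ### Vertices, relation rank and local chains -/

section LinearHypergraph

variable {V ι : Type*} [DecidableEq V] (vec : ι → V →₀ ℚ)

/-- The vertices covered by a list of edges, each edge being given by its coefficient vector. -/
def verts : List ι → Finset V
  | [] => ∅
  | e :: Γ => (vec e).support ∪ verts Γ

/-- The space of linear relations spanned by a list of edges. -/
noncomputable def relSpace (Γ : List ι) : Submodule ℚ (V →₀ ℚ) :=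
  Submodule.span ℚ {x | ∃ e ∈ Γ, vec e = x}

/-- The rank of a list of edges. -/
noncomputable def relRank (Γ : List ι) : ℕ := Module.finrank ℚ (relSpace vec Γ)

/-- The scaled exponent of the expected number of copies of a configuration. -/
noncomputable def weight (k l : ℕ) (Γ : List ι) : ℤ :=
  l * (verts vec Γ).card - k * (l - 1) * relRank vec Γ

/-- The edge `e` meets the vertices of `Γ` in a single vertex, which lies in one of the first `W`
edges of `Γ`. -/
def Attaches (W : ℕ) (e : ι) (Γ : List ι) : Prop :=
  ∃ v, (vec e).support ∩ verts vec Γ = {v} ∧ v ∈ verts vec (Γ.take W)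

/-- `c ++ h` arises from `h` by attaching the edges of `c` one after the other. -/
def IsLocalChain (W : ℕ) : List ι → List ι → Prop
  | [], _ => True
  | e :: c, h => Attaches vec W e (c ++ h) ∧ IsLocalChain W c h

variable {vec}

theorem mem_verts {Γ : List ι} {v : V} : v ∈ verts vec Γ ↔ ∃ e ∈ Γ, v ∈ (vec e).support := by
  induction Γ with
  | nil => simp [verts]
  | cons e Γ ih => simp only [verts, Finset.mem_union, ih]; simp

theorem verts_append (Γ Δ : List ι) : verts vec (Γ ++ Δ) = verts vec Γ ∪ verts vec Δ := by
  ext v; simp only [Finset.mem_union, mem_verts, List.mem_append]; grind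

theorem verts_mono {Γ Δ : List ι} (h : ∀ e ∈ Γ, e ∈ Δ) : verts vec Γ ⊆ verts vec Δ := by
  intro v hv
  obtain ⟨e, he, hev⟩ := mem_verts.1 hv
  exact mem_verts.2 ⟨e, h e he, hev⟩

theorem support_subset_verts {Γ : List ι} {e : ι} (he : e ∈ Γ) :
    (vec e).support ⊆ verts vec Γ := fun _ hv => mem_verts.2 ⟨e, he, hv⟩

theorem vec_mem_relSpace {Γ : List ι} {e : ι} (he : e ∈ Γ) : vec e ∈ relSpace vec Γ :=
  Submodule.subset_span ⟨e, he, rfl⟩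

theorem relSpace_cons (e : ι) (Γ : List ι) :
    relSpace vec (e :: Γ) = Submodule.span ℚ {vec e} ⊔ relSpace vec Γ := by
  rw [relSpace, relSpace, ← Submodule.span_insert]
  congr 1
  ext x; simp [eq_comm]

instance finite_relSpace (Γ : List ι) : FiniteDimensional ℚ (relSpace vec Γ) := by
  apply FiniteDimensional.span_of_finite
  have : {x | ∃ e ∈ Γ, vec e = x} = vec '' {e | e ∈ Γ} := by ext; simp
  rw [this]
  exact (List.finite_toSet Γ).image _

theorem relRank_nil : relRank vec [] = 0 := by
  have : {x | ∃ e ∈ ([] : List ι), vec e = x} = ∅ := by ext; simp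
  rw [relRank, relSpace, this, Submodule.span_empty, finrank_bot]

theorem relRank_cons_of_notMem {e : ι} {Γ : List ι} (he : vec e ∉ relSpace vec Γ) :
    relRank vec (e :: Γ) = relRank vec Γ + 1 := by
  have h0 : vec e ≠ 0 := fun h => he (h ▸ Submodule.zero_mem _)
  have hd : Submodule.span ℚ {vec e} ⊓ relSpace vec Γ = ⊥ := by
    rw [← disjoint_iff, disjoint_comm, Submodule.disjoint_span_singleton' h0]
    exact he
  have := Submodule.finrank_sup_add_finrank_inf_eq (Submodule.span ℚ {vec e}) (relSpace vec Γ)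
  rw [hd, finrank_bot, finrank_span_singleton h0] at this
  rw [relRank, relSpace_cons, relRank]
  omega

theorem relSpace_mono {Γ Δ : List ι} (h : ∀ e ∈ Γ, e ∈ Δ) :
    relSpace vec Γ ≤ relSpace vec Δ := by
  apply Submodule.span_mono
  rintro x ⟨e, he, rfl⟩
  exact ⟨e, h e he, rfl⟩

theorem relRank_mono {Γ Δ : List ι} (h : ∀ e ∈ Γ, e ∈ Δ) : relRank vec Γ ≤ relRank vec Δ :=
  Submodule.finrank_mono (relSpace_mono h)

theorem eq_zero_of_mem_relSpace {Γ : List ι} {x : V →₀ ℚ} (hx : x ∈ relSpace vec Γ) {v : V}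
    (hv : v ∉ verts vec Γ) : x v = 0 := by
  induction hx using Submodule.span_induction with
  | mem x h =>
    obtain ⟨e, he, rfl⟩ := h
    by_contra h0
    exact hv (mem_verts.2 ⟨e, he, by simpa using h0⟩)
  | zero => rfl
  | add x y _ _ hx hy => simp [hx, hy]
  | smul a x _ hx => simp [hx]

theorem notMem_relSpace_of_new {Γ : List ι} {x : V →₀ ℚ} {v : V} (hx : v ∈ x.support)
    (hv : v ∉ verts vec Γ) : x ∉ relSpace vec Γ :=
  fun h => (Finsupp.mem_support_iff.1 hx) (eq_zero_of_mem_relSpace h hv)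

/-- Only `g` can involve the coordinates `w` and `w'`, so on this pair every vector of the span is
proportional to `vec g`, which is non-zero at `w'`. This shows that an edge without new vertices can
still raise the rank. -/
theorem notMem_relSpace_of_private {Γ : List ι} {g : ι} {w w' : V} {x : V →₀ ℚ}
    (hw' : w' ∈ (vec g).support)
    (hp : ∀ e ∈ Γ, e ≠ g → w ∉ (vec e).support ∧ w' ∉ (vec e).support)
    (hxw : w ∈ x.support) (hxw' : w' ∉ x.support) : x ∉ relSpace vec Γ := by
  intro hx
  have key : x w * vec g w' = x w' * vec g w := by
    clear hxw hxw'
    induction hx using Submodule.span_induction with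
    | mem x h =>
      obtain ⟨e, he, rfl⟩ := h
      by_cases heg : e = g
      · subst heg; ring
      · have := hp e he heg
        simp only [Finsupp.mem_support_iff, not_not] at this
        simp [this.1, this.2]
    | zero => simp
    | add x y _ _ hx hy => simp [add_mul, hx, hy]
    | smul a x _ hx => simp [mul_assoc, hx]
  simp only [Finsupp.mem_support_iff, not_not] at *
  rw [hxw', zero_mul] at key
  exact (mul_ne_zero hxw hw') key

theorem mem_relSpace_cons {e : ι} {Γ : List ι} {x : V →₀ ℚ} :
    x ∈ relSpace vec (e :: Γ) ↔ ∃ a : ℚ, ∃ y ∈ relSpace vec Γ, x = a • vec e + y := by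
  rw [relSpace_cons, Submodule.mem_sup]
  constructor
  · rintro ⟨y, hy, z, hz, rfl⟩
    obtain ⟨a, rfl⟩ := Submodule.mem_span_singleton.1 hy
    exact ⟨a, z, hz, rfl⟩
  · rintro ⟨a, y, hy, rfl⟩
    exact ⟨_, Submodule.mem_span_singleton.2 ⟨a, rfl⟩, y, hy, rfl⟩

/-- Each attached edge has one old vertex and hence at least one new one. In the first-moment bound
this supplies one factor of the small constant per chain edge. -/
theorem IsLocalChain.length_le_card {W : ℕ} {c h : List ι} (hc : IsLocalChain vec W c h)
    (h2 : ∀ e ∈ c, 2 ≤ (vec e).support.card) : c.length ≤ (verts vec (c ++ h)).card := by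
  induction c with
  | nil => simp
  | cons e c ih =>
    obtain ⟨⟨v, hv, -⟩, hc⟩ := hc
    have := ih hc fun e he => h2 e (by simp [he])
    have h3 := Finset.card_union_add_card_inter (vec e).support (verts vec (c ++ h))
    rw [hv, Finset.card_singleton] at h3
    have := h2 e (by simp)
    simp only [List.cons_append, verts, List.length_cons]
    omega

theorem IsLocalChain.append {W : ℕ} {c d h : List ι} (hc : IsLocalChain vec W c h)
    (hd : IsLocalChain vec W d (c ++ h)) : IsLocalChain vec W (d ++ c) h := by
  induction d with
  | nil => simpa
  | cons e d ih => exact ⟨by simpa using hd.1, ih hd.2⟩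

end LinearHypergraph

/-! ### Minimal unavoidable families -/

section Core

variable {V ι : Type*} [DecidableEq V] (vec : ι → V →₀ ℚ)

/-- Every `2`-colouring of the vertices has an edge all of whose vertices have the colour
forbidden for that edge. -/
def Unavoidable (τ : ι → Bool) (𝓐 : Finset ι) : Prop :=
  ∀ χ : V → Bool, ∃ e ∈ 𝓐, ∀ v ∈ (vec e).support, χ v = τ e

/-- Some configuration of edges has negative weight; it consists of a local chain of length at
most `L`, its starting edges, and at most `D` additional edges. -/
def HasDenseConfig (k l W D L : ℕ) (𝓐 : Finset ι) : Prop :=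
  ∃ t c h : List ι, (∀ e ∈ t ++ (c ++ h), e ∈ 𝓐) ∧ h.length ≤ 3 ∧ t.length ≤ D ∧ c.length ≤ L ∧
    IsLocalChain vec W c h ∧ weight vec k l (t ++ (c ++ h)) < 0

/-- Some local chain has length about `L` and weight at most `k`. -/
def HasLongChain (k l W L : ℕ) (𝓐 : Finset ι) : Prop :=
  ∃ c h : List ι, (∀ e ∈ c ++ h, e ∈ 𝓐) ∧ h.length ≤ 3 ∧ L ≤ c.length ∧ c.length ≤ L + l ∧
    IsLocalChain vec W c h ∧ weight vec k l (c ++ h) ≤ k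

variable {vec}

/-- By minimality some colouring is bad for `e` alone. Flipping it at `v` repairs `e`, so another
edge `f` becomes bad. It must contain `v`, and it is monochromatic in the flipped colour, which no
other vertex of `e` has. -/
theorem exists_cross_edge [DecidableEq ι] {τ : ι → Bool} {𝓐 : Finset ι}
    (hA : Unavoidable vec τ 𝓐) (hmin : ∀ e ∈ 𝓐, ¬ Unavoidable vec τ (𝓐.erase e))
    {e : ι} (he : e ∈ 𝓐) {v : V} (hv : v ∈ (vec e).support) :
    ∃ f ∈ 𝓐, τ f ≠ τ e ∧ (vec e).support ∩ (vec f).support = {v} := by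
  have h := hmin e he
  simp only [Unavoidable, not_forall, not_exists, not_and] at h
  obtain ⟨χ, hχ⟩ := h
  have hmono : ∀ x ∈ (vec e).support, χ x = τ e := by
    obtain ⟨f, hf, hfχ⟩ := hA χ
    by_cases hfe : f = e
    · subst hfe; exact hfχ
    · obtain ⟨x, hx, hne⟩ := hχ f (Finset.mem_erase.2 ⟨hfe, hf⟩)
      exact absurd (hfχ x hx) hne
  obtain ⟨f, hf, hfχ⟩ := hA (Function.update χ v (!τ e))
  have hfe : f ≠ e := by
    rintro rfl
    simpa using hfχ v hv
  have hvf : v ∈ (vec f).support := by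
    by_contra hvf
    obtain ⟨x, hx, hne⟩ := hχ f (Finset.mem_erase.2 ⟨hfe, hf⟩)
    have := hfχ x hx
    rw [Function.update_of_ne (by rintro rfl; exact hvf hx)] at this
    exact hne this
  have hτ : τ f = !τ e := by simpa using (hfχ v hvf).symm
  refine ⟨f, hf, by simp [hτ], ?_⟩
  ext x
  simp only [Finset.mem_inter, Finset.mem_singleton]
  constructor
  · rintro ⟨hxe, hxf⟩
    by_contra hxv
    have := hfχ x hxf
    rw [Function.update_of_ne hxv, hmono x hxe, hτ] at this
    simp at this
  · rintro rfl; exact ⟨hv, hvf⟩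

theorem exists_minimal_unavoidable [DecidableEq ι] {τ : ι → Bool} {𝓐 : Finset ι}
    (hA : Unavoidable vec τ 𝓐) :
    ∃ 𝓑 ⊆ 𝓐, Unavoidable vec τ 𝓑 ∧ ∀ e ∈ 𝓑, ¬ Unavoidable vec τ (𝓑.erase e) := by
  induction 𝓐 using Finset.strongInduction with
  | H 𝓐 ih =>
    by_cases h : ∃ e ∈ 𝓐, Unavoidable vec τ (𝓐.erase e)
    · obtain ⟨e, he, hu⟩ := h
      obtain ⟨𝓑, hB, h⟩ := ih _ (Finset.erase_ssubset he) hu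
      exact ⟨𝓑, hB.trans (Finset.erase_subset _ _), h⟩
    · exact ⟨𝓐, subset_rfl, hA, fun e he hu => h ⟨e, he, hu⟩⟩

theorem weight_cons_of_not_subset {k l : ℕ} {e : ι} {Γ : List ι}
    (he : ¬ (vec e).support ⊆ verts vec Γ) :
    weight vec k l (e :: Γ) = weight vec k l Γ + l * (vec e).support.card
      - l * ((vec e).support ∩ verts vec Γ).card - k * (l - 1) := by
  obtain ⟨v, hv, hvΓ⟩ := Finset.not_subset.1 he
  have h1 := relRank_cons_of_notMem (notMem_relSpace_of_new hv hvΓ)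
  have h2 := Finset.card_union_add_card_inter (vec e).support (verts vec Γ)
  simp only [weight, verts, h1]
  push_cast
  have h3 : ((((vec e).support ∪ verts vec Γ).card : ℕ) : ℤ) = (vec e).support.card +
    (verts vec Γ).card - ((vec e).support ∩ verts vec Γ).card := by omega
  rw [h3]; ring

theorem weight_cons_of_subset {k l : ℕ} {e : ι} {Γ : List ι}
    (he : (vec e).support ⊆ verts vec Γ) (hr : vec e ∉ relSpace vec Γ) :
    weight vec k l (e :: Γ) = weight vec k l Γ - k * (l - 1) := by
  simp only [weight, verts, relRank_cons_of_notMem hr, Finset.union_eq_right.2 he]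
  push_cast
  ring

end Core

/-! ### Exploration when k = l -/

section EqualLengths

variable {V ι : Type*} [DecidableEq V] {vec : ι → V →₀ ℚ}

/-- Three edges forming a loose triangle. -/
def IsTriangle (vec : ι → V →₀ ℚ) (G F₁ F₂ : ι) (u w₁ w₂ z₁ z₂ n : V) : Prop :=
  (vec G).support = {u, w₁, w₂} ∧ (vec F₁).support = {w₁, n, z₁} ∧
    (vec F₂).support = {w₂, n, z₂} ∧ [u, w₁, w₂, n].Nodup ∧ z₁ ∉ [u, w₁, w₂, n] ∧
    z₂ ∉ [u, w₁, w₂, n]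

theorem exists_third {s : Finset V} (hs : s.card = 3) {a b : V} (ha : a ∈ s) (hb : b ∈ s)
    (hab : a ≠ b) : ∃ c, s = {a, b, c} ∧ c ≠ a ∧ c ≠ b := by
  have h1 : ((s.erase a).erase b).card = 1 := by
    rw [Finset.card_erase_of_mem (Finset.mem_erase.2 ⟨hab.symm, hb⟩),
      Finset.card_erase_of_mem ha, hs]
  obtain ⟨c, hc⟩ := Finset.card_eq_one.1 h1
  have hc' : c ∈ (s.erase a).erase b := by simp [hc]
  simp only [Finset.mem_erase] at hc'
  refine ⟨c, ?_, hc'.2.1, hc'.1⟩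
  ext x
  have := congrArg (x ∈ ·) hc
  simp only [Finset.mem_erase, Finset.mem_singleton, eq_iff_iff] at this
  simp only [Finset.mem_insert, Finset.mem_singleton]
  by_cases hxa : x = a
  · simp [hxa, ha]
  · by_cases hxb : x = b
    · simp [hxb, hb]
    · tauto

/-- For k = l, attaching at a single vertex is free, and each further common vertex costs k. -/
theorem weight_cons_of_card_eq {k : ℕ} {e : ι} {Γ : List ι}
    (hcard : (vec e).support.card = k) (he : ¬ (vec e).support ⊆ verts vec Γ) :
    weight vec k k (e :: Γ) + k * (((vec e).support ∩ verts vec Γ).card - 1) =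
      weight vec k k Γ := by
  rw [weight_cons_of_not_subset he, hcard]
  ring

/-- One step of the exploration of a core all of whose edges have the same size. -/
theorem path_extend {k : ℕ} (hk : 3 ≤ k) {𝓐 : Finset ι}
    (hcard : ∀ e ∈ 𝓐, (vec e).support.card = k)
    (hcross : ∀ e ∈ 𝓐, ∀ v ∈ (vec e).support,
      ∃ f ∈ 𝓐, (vec e).support ∩ (vec f).support = {v})
    {Γ : List ι} {G : ι} (hG : G ∈ 𝓐) {P : Finset V} (hP : P ⊆ (vec G).support)
    (hPcard : P.card = k - 1) (hPΓ : Disjoint P (verts vec Γ))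
    (hw : weight vec k k (G :: Γ) ≤ k) :
    (∃ F ∈ 𝓐, ∃ w ∈ (vec G).support, (vec F).support ∩ verts vec (G :: Γ) = {w}) ∨
    (∃ t : List ι, t.length ≤ 3 ∧ (∀ e ∈ t, e ∈ 𝓐) ∧ weight vec k k (t ++ G :: Γ) < 0) ∨
    (k = 3 ∧ 0 < weight vec k k (G :: Γ) ∧ ∃ F₁ ∈ 𝓐, ∃ F₂ ∈ 𝓐, ∃ u w₁ w₂ z₁ z₂ n,
      IsTriangle vec G F₁ F₂ u w₁ w₂ z₁ z₂ n) := by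
  have hpriv : ∀ {v}, v ∈ P → v ∉ verts vec Γ := fun hv => Finset.disjoint_left.1 hPΓ hv
  obtain ⟨w₁, hw₁, w₂, hw₂, h12⟩ := Finset.one_lt_card.1 (by omega : 1 < P.card)
  by_contra hcon
  push Not at hcon
  obtain ⟨hext, hdense, htri⟩ := hcon
  have hkpos : (3 : ℤ) ≤ k := by exact_mod_cast hk
  -- behaviour of any edge crossing `G` at a private vertex
  have hmeet : ∀ F ∈ 𝓐, ∀ w ∈ P, (vec G).support ∩ (vec F).support = {w} →
      2 ≤ ((vec F).support ∩ verts vec (G :: Γ)).card := by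
    intro F hF w hwP hFw
    have hwF : w ∈ (vec F).support ∧ w ∈ (vec G).support := by
      have : w ∈ (vec G).support ∩ (vec F).support := by simp [hFw]
      simpa [and_comm] using this
    by_contra hlt
    apply hext F hF w hwF.2
    symm
    apply Finset.eq_of_subset_of_card_le
    · simp only [Finset.singleton_subset_iff, Finset.mem_inter]
      exact ⟨hwF.1, support_subset_verts (by simp) hwF.2⟩
    · simp only [Finset.card_singleton]; omega
  -- As no extension exists, both crossing edges meet the configuration at least twice. `F₁` costs
  -- at least k and brings the weight down to at most 0. So `F₂` may cost nothing more: it has no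
  -- new vertex and depends linearly on the rest.
  obtain ⟨F₁, hF₁, hGF₁⟩ := hcross G hG w₁ (hP hw₁)
  obtain ⟨F₂, hF₂, hGF₂⟩ := hcross G hG w₂ (hP hw₂)
  have hm1 : ∀ x, x ∈ (vec G).support → x ∈ (vec F₁).support → x = w₁ := fun x h1 h2 => by
    simpa [hGF₁] using Finset.mem_inter.2 ⟨h1, h2⟩
  have hm2 : ∀ x, x ∈ (vec G).support → x ∈ (vec F₂).support → x = w₂ := fun x h1 h2 => by
    simpa [hGF₂] using Finset.mem_inter.2 ⟨h1, h2⟩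
  have hw1F : w₁ ∈ (vec F₁).support := (Finset.mem_inter.1 (by rw [hGF₁]; simp :
    w₁ ∈ (vec G).support ∩ (vec F₁).support)).2
  have hw2F : w₂ ∈ (vec F₂).support := (Finset.mem_inter.1 (by rw [hGF₂]; simp :
    w₂ ∈ (vec G).support ∩ (vec F₂).support)).2
  have ht1 := hmeet F₁ hF₁ w₁ hw₁ hGF₁
  have ht2 := hmeet F₂ hF₂ w₂ hw₂ hGF₂
  have hprivΓ : ∀ v ∈ P, ∀ e ∈ Γ, v ∉ (vec e).support := fun v hv e he hve =>
    hpriv hv (support_subset_verts he hve)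
  -- the first crossing edge
  have hns1 : ¬ (vec F₁).support ⊆ verts vec (G :: Γ) := by
    intro hsub
    have hnm : vec F₁ ∉ relSpace vec (G :: Γ) := by
      refine notMem_relSpace_of_private (g := G) (w := w₁) (w' := w₂) (hP hw₂) ?_ hw1F
        (fun h => h12 (hm1 w₂ (hP hw₂) h).symm)
      intro e he hne
      rcases List.mem_cons.1 he with rfl | he
      · exact absurd rfl hne
      · exact ⟨hprivΓ _ hw₁ e he, hprivΓ _ hw₂ e he⟩
    have := hdense [F₁] (by simp) (by simpa using hF₁)
    rw [List.singleton_append, weight_cons_of_subset hsub hnm] at this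
    nlinarith
  have hwt1 := weight_cons_of_card_eq (hcard F₁ hF₁) hns1
  have hd1 := hdense [F₁] (by simp) (by simpa using hF₁)
  rw [List.singleton_append] at hd1
  have ht1' : ((vec F₁).support ∩ verts vec (G :: Γ)).card = 2 := by
    by_contra hne
    have : (3 : ℤ) ≤ ((vec F₁).support ∩ verts vec (G :: Γ)).card := by
      exact_mod_cast (by omega : 3 ≤ ((vec F₁).support ∩ verts vec (G :: Γ)).card)
    nlinarith
  rw [ht1'] at hwt1
  norm_num at hwt1
  have hw1le : weight vec k k (F₁ :: G :: Γ) ≤ 0 := by linarith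
  have hpos : 0 < weight vec k k (G :: Γ) := by linarith
  -- the second crossing edge
  have hd2 := hdense [F₂, F₁] (by simp) (by simp [hF₁, hF₂])
  have hsub2 : (vec F₂).support ⊆ verts vec (F₁ :: G :: Γ) := by
    by_contra hns2
    have ht2' : 2 ≤ ((vec F₂).support ∩ verts vec (F₁ :: G :: Γ)).card :=
      ht2.trans (Finset.card_le_card (Finset.inter_subset_inter_left
        (verts_mono fun e he => List.mem_cons_of_mem _ he)))
    have h3 := weight_cons_of_card_eq (hcard F₂ hF₂) hns2
    simp only [List.cons_append, List.nil_append] at hd2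
    have : (2 : ℤ) ≤ ((vec F₂).support ∩ verts vec (F₁ :: G :: Γ)).card := by exact_mod_cast ht2'
    nlinarith
  have hmem2 : vec F₂ ∈ relSpace vec (F₁ :: G :: Γ) := by
    by_contra hnm
    simp only [List.cons_append, List.nil_append] at hd2
    rw [weight_cons_of_subset hsub2 hnm] at hd2
    nlinarith
  -- Write F₂ = a F₁ + b G + y' and compare coordinates at private vertices of `G`, where y'
  -- vanishes. At `w₂` this gives b ≠ 0, which a third private vertex would contradict; so k = 3. At
  -- `w₁` it gives a ≠ 0, so `F₂` contains the new vertex `n` of `F₁` as well.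
  obtain ⟨a, y, hy, hF2⟩ := mem_relSpace_cons.1 hmem2
  obtain ⟨b, y', hy', rfl⟩ := mem_relSpace_cons.1 hy
  have hz : ∀ v ∈ P, y' v = 0 := fun v hv => eq_zero_of_mem_relSpace hy' (hpriv hv)
  have hcoord : ∀ v, vec F₂ v = a * vec F₁ v + (b * vec G v + y' v) := fun v => by
    rw [hF2]; simp
  have hnot : ∀ {e : ι} {v}, v ∉ (vec e).support → vec e v = 0 := fun h => by simpa using h
  have hb : b ≠ 0 := by
    rintro rfl
    have := hcoord w₂
    rw [hnot fun h => h12 (hm1 w₂ (hP hw₂) h).symm, hz w₂ hw₂] at this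
    simp only [mul_zero, zero_mul, add_zero] at this
    exact (Finsupp.mem_support_iff.1 hw2F) this
  -- a third private vertex is impossible
  have hk3 : k = 3 := by
    by_contra hne
    have h2 : 2 < P.card := by omega
    obtain ⟨w₃, hw₃, h3⟩ : ∃ w₃ ∈ P, w₃ ∉ ({w₁, w₂} : Finset V) := by
      by_contra hall
      push Not at hall
      have := Finset.card_le_card (show P ⊆ {w₁, w₂} from hall)
      have := Finset.card_le_two (a := w₁) (b := w₂)
      omega
    simp only [Finset.mem_insert, Finset.mem_singleton, not_or] at h3
    have := hcoord w₃
    rw [hnot fun h => h3.1 (hm1 w₃ (hP hw₃) h), hnot fun h => h3.2 (hm2 w₃ (hP hw₃) h),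
      hz w₃ hw₃] at this
    simp only [mul_zero, zero_add, add_zero] at this
    exact mul_ne_zero hb (Finsupp.mem_support_iff.1 (hP hw₃)) this.symm
  have ha : a ≠ 0 := by
    rintro rfl
    have := hcoord w₁
    rw [hnot fun h => h12 (hm2 w₁ (hP hw₁) h), hz w₁ hw₁] at this
    simp only [zero_mul, zero_add, add_zero] at this
    exact mul_ne_zero hb (Finsupp.mem_support_iff.1 (hP hw₁)) this.symm
  obtain ⟨n, hn, hnΓ⟩ := Finset.not_subset.1 hns1
  have hnG : n ∉ (vec G).support := fun h => hnΓ (support_subset_verts (by simp) h)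
  have hnF2 : n ∈ (vec F₂).support := by
    rw [Finsupp.mem_support_iff, hcoord n, hnot hnG, eq_zero_of_mem_relSpace hy'
      (fun h => hnΓ (verts_mono (fun e he => List.mem_cons_of_mem _ he) h))]
    simpa using ⟨ha, Finsupp.mem_support_iff.1 hn⟩
  have hG3 := hcard G hG
  have hF13 := hcard F₁ hF₁
  have hF23 := hcard F₂ hF₂
  rw [hk3] at hG3 hF13 hF23
  have hn1 : w₁ ≠ n := by rintro rfl; exact hnG (hP hw₁)
  have hn2 : w₂ ≠ n := by rintro rfl; exact hnG (hP hw₂)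
  obtain ⟨u, hGu, hu1, hu2⟩ := exists_third hG3 (hP hw₁) (hP hw₂) h12
  obtain ⟨z₁, hFz1, hz11, hz1n⟩ := exists_third hF13 hw1F hn hn1
  obtain ⟨z₂, hFz2, hz22, hz2n⟩ := exists_third hF23 hw2F hnF2 hn2
  have huG : u ∈ (vec G).support := by simp [hGu]
  have hz1G : z₁ ∉ (vec G).support := fun h => hz11 (hm1 z₁ h (by simp [hFz1]))
  have hz2G : z₂ ∉ (vec G).support := fun h => hz22 (hm2 z₂ h (by simp [hFz2]))
  refine htri hk3 hpos F₁ hF₁ F₂ hF₂ u w₁ w₂ z₁ z₂ n ⟨?_, hFz1, hFz2, ?_, ?_, ?_⟩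
  · rw [hGu]; ext; simp; tauto
  · have : u ≠ n := by rintro rfl; exact hnG huG
    simp [*]
  · rw [hGu] at hz1G
    simp only [Finset.mem_insert, Finset.mem_singleton, not_or] at hz1G
    simp [hz1G, hz1n]
  · rw [hGu] at hz2G
    simp only [Finset.mem_insert, Finset.mem_singleton, not_or] at hz2G
    simp [hz2G, hz2n]

end EqualLengths

/-! ### Loose triangles, and the conclusion for k = l -/

section EqualLengths

variable {V ι : Type*} [DecidableEq V] {vec : ι → V →₀ ℚ}

/-- At most six vertices and rank three give 3·6 - 6·3 = 0, and identifying `z₁` with `z₂` removes a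
vertex. The edge `F₂` is independent because `w₂` and `u` are private to `G` as against `F₁`. -/
theorem IsTriangle.weight_le {G F₁ F₂ : ι} {u w₁ w₂ z₁ z₂ n : V}
    (h : IsTriangle vec G F₁ F₂ u w₁ w₂ z₁ z₂ n) :
    weight vec 3 3 [F₂, F₁, G] ≤ 0 ∧ (z₁ = z₂ → weight vec 3 3 [F₂, F₁, G] < 0) := by
  obtain ⟨hG, hF₁, hF₂, hnd, hz₁, hz₂⟩ := h
  simp only [List.nodup_cons, List.mem_cons, List.not_mem_nil, or_false, not_or] at hnd hz₁ hz₂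
  have hr1 : relRank vec [G] = 1 := by
    rw [relRank_cons_of_notMem, relRank_nil]
    exact notMem_relSpace_of_new (v := u) (by simp [hG]) (by simp [verts])
  have hr2 : relRank vec [F₁, G] = 2 := by
    rw [relRank_cons_of_notMem, hr1]
    refine notMem_relSpace_of_new (v := n) (by simp [hF₁]) ?_
    simp only [verts, hG, Finset.union_empty, Finset.mem_insert, Finset.mem_singleton]
    tauto
  have hr3 : relRank vec [F₂, F₁, G] = 3 := by
    rw [relRank_cons_of_notMem, hr2]
    refine notMem_relSpace_of_private (g := G) (w := w₂) (w' := u) (by simp [hG]) ?_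
      (by simp [hF₂]) ?_
    · intro e he hne
      simp only [List.mem_cons, List.not_mem_nil, or_false, hne] at he
      rw [he, hF₁]
      simp only [Finset.mem_insert, Finset.mem_singleton]
      grind
    · rw [hF₂]
      simp only [Finset.mem_insert, Finset.mem_singleton]
      grind
  have hv : verts vec [F₂, F₁, G] ⊆ [u, w₁, w₂, n, z₁, z₂].toFinset := by
    intro x
    simp only [verts, hG, hF₁, hF₂]
    simp
    tauto
  constructor
  · have h1 := (Finset.card_le_card hv).trans (List.toFinset_card_le _)
    simp only [List.length_cons, List.length_nil] at h1
    rw [weight, hr3]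
    push_cast
    omega
  · rintro rfl
    have hv' : verts vec [F₂, F₁, G] ⊆ [u, w₁, w₂, n, z₁].toFinset :=
      hv.trans (by intro x; simp)
    have h1 := (Finset.card_le_card hv').trans (List.toFinset_card_le _)
    simp only [List.length_cons, List.length_nil] at h1
    rw [weight, hr3]
    push_cast
    omega

/-- If `x` vanishes at `u`, then `G` does not occur in it. If it also vanishes at `n`, then `F₁` and
`F₂` occur both or not at all, and the support has four elements or none. -/
theorem IsTriangle.mem_support_of_mem_relSpace {G F₁ F₂ : ι} {u w₁ w₂ z₁ z₂ n : V}
    (h : IsTriangle vec G F₁ F₂ u w₁ w₂ z₁ z₂ n) (hz : z₁ ≠ z₂) {x : V →₀ ℚ}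
    (hx : x ∈ relSpace vec [F₂, F₁, G]) (hcard : x.support.card = 3) :
    u ∈ x.support ∨ n ∈ x.support := by
  obtain ⟨hG, hF₁, hF₂, hnd, hz₁, hz₂⟩ := h
  simp only [List.nodup_cons, List.mem_cons, List.not_mem_nil, or_false, not_or] at hnd hz₁ hz₂
  by_contra hcon
  rw [not_or] at hcon
  obtain ⟨b, y, hy, rfl⟩ := mem_relSpace_cons.1 hx
  obtain ⟨a, y', hy', rfl⟩ := mem_relSpace_cons.1 hy
  obtain ⟨g, y'', hy'', rfl⟩ := mem_relSpace_cons.1 hy'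
  have hy0 : y'' = 0 := by
    ext v
    exact eq_zero_of_mem_relSpace hy'' (by simp [verts])
  subst hy0
  have mG : ∀ v, vec G v ≠ 0 ↔ v = u ∨ v = w₁ ∨ v = w₂ := fun v => by
    rw [← Finsupp.mem_support_iff, hG]; simp
  have mF₁ : ∀ v, vec F₁ v ≠ 0 ↔ v = w₁ ∨ v = n ∨ v = z₁ := fun v => by
    rw [← Finsupp.mem_support_iff, hF₁]; simp
  have mF₂ : ∀ v, vec F₂ v ≠ 0 ↔ v = w₂ ∨ v = n ∨ v = z₂ := fun v => by
    rw [← Finsupp.mem_support_iff, hF₂]; simp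
  simp only [Finsupp.mem_support_iff, not_not, Finsupp.add_apply, Finsupp.smul_apply,
    smul_eq_mul, add_zero] at hcon
  have hg : g = 0 := by
    have h1 : vec F₁ u = 0 := by_contra fun h => by have := (mF₁ u).1 h; grind
    have h2 : vec F₂ u = 0 := by_contra fun h => by have := (mF₂ u).1 h; grind
    have h3 : vec G u ≠ 0 := (mG u).2 (by simp)
    simpa [h1, h2, h3] using hcon.1
  subst hg
  have hn1 : vec F₁ n ≠ 0 := (mF₁ n).2 (by simp)
  have hn2 : vec F₂ n ≠ 0 := (mF₂ n).2 (by simp)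
  have hab : b = 0 ↔ a = 0 := by
    have := hcon.2
    constructor
    · rintro rfl; simpa [hn1] using this
    · rintro rfl; simpa [hn2] using this
  by_cases ha : a = 0
  · rw [ha, hab.2 ha] at hcard
    simp at hcard
  · have hb : b ≠ 0 := fun h => ha (hab.1 h)
    have key : [w₁, w₂, z₁, z₂].toFinset ⊆
        (b • vec F₂ + (a • vec F₁ + ((0 : ℚ) • vec G + 0))).support := by
      intro v hv
      simp only [List.toFinset_cons, List.toFinset_nil, Finset.mem_insert, insert_empty_eq,
        Finset.mem_singleton] at hv
      simp only [Finsupp.mem_support_iff, Finsupp.add_apply, Finsupp.smul_apply,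
        smul_eq_mul, add_zero, zero_mul]
      rcases hv with rfl | rfl | rfl | rfl
      · have h1 : vec F₂ v = 0 := by_contra fun h => by have := (mF₂ v).1 h; grind
        rw [h1]; simpa using ⟨ha, (mF₁ v).2 (by simp)⟩
      · have h1 : vec F₁ v = 0 := by_contra fun h => by have := (mF₁ v).1 h; grind
        rw [h1]; simpa using ⟨hb, (mF₂ v).2 (by simp)⟩
      · have h1 : vec F₂ v = 0 := by_contra fun h => by have := (mF₂ v).1 h; grind
        rw [h1]; simpa using ⟨ha, (mF₁ v).2 (by simp)⟩
      · have h1 : vec F₁ v = 0 := by_contra fun h => by have := (mF₁ v).1 h; grind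
        rw [h1]; simpa using ⟨hb, (mF₂ v).2 (by simp)⟩
    have hnd4 : [w₁, w₂, z₁, z₂].Nodup := by
      simp only [List.nodup_cons, List.mem_cons, List.not_mem_nil, or_false, not_or]
      grind
    have := Finset.card_le_card key
    rw [List.toFinset_card_of_nodup hnd4, hcard] at this
    simp at this

/-- A local chain whose last edge has private vertices at which it may be continued. -/
def IsPath (vec : ι → V →₀ ℚ) (k W : ℕ) (𝓐 : Finset ι) (w : ℤ) (c h : List ι) : Prop :=
  IsLocalChain vec W c h ∧ (∀ e ∈ c ++ h, e ∈ 𝓐) ∧ weight vec k k (c ++ h) ≤ w ∧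
    ∃ G Γ P, c ++ h = G :: Γ ∧ P ⊆ (vec G).support ∧ P.card = k - 1 ∧ Disjoint P (verts vec Γ)

theorem weight_cons_of_inter_eq_singleton {k : ℕ} (hk : 2 ≤ k) {e : ι} {Γ : List ι} {v : V}
    (hcard : (vec e).support.card = k) (hv : (vec e).support ∩ verts vec Γ = {v}) :
    weight vec k k (e :: Γ) = weight vec k k Γ := by
  have hns : ¬ (vec e).support ⊆ verts vec Γ := fun h => by
    rw [Finset.inter_eq_left.2 h] at hv
    rw [hv, Finset.card_singleton] at hcard
    omega
  have := weight_cons_of_card_eq hcard hns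
  rw [hv] at this
  simpa using this

theorem IsPath.cons {k W : ℕ} (hk : 2 ≤ k) {𝓐 : Finset ι}
    (hcard : ∀ e ∈ 𝓐, (vec e).support.card = k) {w : ℤ} {c h : List ι}
    (hc : IsLocalChain vec W c h) (hmem : ∀ e ∈ c ++ h, e ∈ 𝓐)
    (hw : weight vec k k (c ++ h) ≤ w) {F : ι} (hF : F ∈ 𝓐) {v : V}
    (hv : (vec F).support ∩ verts vec (c ++ h) = {v}) (hvW : v ∈ verts vec ((c ++ h).take W)) :
    IsPath vec k W 𝓐 w (F :: c) h := by
  refine ⟨⟨⟨v, hv, hvW⟩, hc⟩, ?_, ?_, F, c ++ h, (vec F).support.erase v, rfl,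
    Finset.erase_subset _ _, ?_, ?_⟩
  · intro e he
    rcases List.mem_cons.1 he with rfl | he
    · exact hF
    · exact hmem e he
  · rw [List.cons_append, weight_cons_of_inter_eq_singleton hk (hcard F hF) hv]
    exact hw
  · have : v ∈ (vec F).support ∩ verts vec (c ++ h) := by simp [hv]
    rw [Finset.card_erase_of_mem (Finset.mem_inter.1 this).1, hcard F hF]
  · rw [Finset.disjoint_left]
    intro x hx hx'
    have : x ∈ (vec F).support ∩ verts vec (c ++ h) :=
      Finset.mem_inter.2 ⟨Finset.mem_of_mem_erase hx, hx'⟩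
    rw [hv, Finset.mem_singleton] at this
    exact (Finset.ne_of_mem_erase hx) this

/-- The weight bound `w` is kept as a parameter so that the exploration can be restarted with `w =
0`, where the triangle alternative is void. -/
theorem IsPath.iterate {k W L : ℕ} (hk : 3 ≤ k) (hW : 1 ≤ W) {𝓐 : Finset ι}
    (hcard : ∀ e ∈ 𝓐, (vec e).support.card = k)
    (hcross : ∀ e ∈ 𝓐, ∀ v ∈ (vec e).support,
      ∃ f ∈ 𝓐, (vec e).support ∩ (vec f).support = {v})
    {w : ℤ} (hwk : w ≤ k) {c h : List ι} (hh : h.length ≤ 3) (hp : IsPath vec k W 𝓐 w c h)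
    (m : ℕ) (hm : c.length + m ≤ L) :
    HasDenseConfig vec k k W 3 L 𝓐 ∨
    (k = 3 ∧ 0 < w ∧ ∃ G ∈ 𝓐, ∃ F₁ ∈ 𝓐, ∃ F₂ ∈ 𝓐, ∃ u w₁ w₂ z₁ z₂ n,
      IsTriangle vec G F₁ F₂ u w₁ w₂ z₁ z₂ n) ∨
    ∃ c', c'.length = c.length + m ∧ IsPath vec k W 𝓐 w c' h := by
  induction m with
  | zero => exact Or.inr (Or.inr ⟨c, rfl, hp⟩)
  | succ m ih =>
    rcases ih (by omega) with h1 | h1 | ⟨c', hc', hchain, hmem, hw, G, Γ, P, heq, hP, hPc, hPd⟩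
    · exact Or.inl h1
    · exact Or.inr (Or.inl h1)
    have hG : G ∈ 𝓐 := hmem G (by simp [heq])
    rcases path_extend hk hcard hcross hG hP hPc hPd (by rw [← heq]; linarith) with
      ⟨F, hF, v, hvG, hv⟩ | ⟨t, ht, htA, hwt⟩ | ⟨hk3, hpos, h2⟩
    · refine Or.inr (Or.inr ⟨F :: c', by simp [hc']; omega, ?_⟩)
      refine IsPath.cons (by omega) hcard hchain hmem hw hF (v := v) (by rw [heq]; exact hv) ?_
      refine mem_verts.2 ⟨G, ?_, hvG⟩
      rw [heq]
      obtain ⟨W', rfl⟩ : ∃ W', W = W' + 1 := ⟨W - 1, by omega⟩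
      simp
    · refine Or.inl ⟨t, c', h, ?_, hh, ht, by omega, hchain, by rw [heq]; exact hwt⟩
      intro e he
      rcases List.mem_append.1 he with he | he
      · exact htA e he
      · exact hmem e he
    · exact Or.inr (Or.inl ⟨hk3, by rw [← heq] at hpos; linarith, G, hG, h2⟩)

/-- A single edge has weight k and starts the exploration. If a triangle turns up, its weight is at
most 0. An edge leaving it at one vertex restarts the exploration from weight 0, one leaving it at
several vertices makes the weight negative, and so does an independent edge inside it. A triangle
with none of these can be recoloured on its own, against unavoidability. -/
theorem dense_or_long_of_equal_lengths [DecidableEq ι] {k W L : ℕ} (hk : 3 ≤ k) (hW : 3 ≤ W)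
    {τ : ι → Bool} {𝓐 : Finset ι} (hcard : ∀ e ∈ 𝓐, (vec e).support.card = k)
    (hA : Unavoidable vec τ 𝓐) (hmin : ∀ e ∈ 𝓐, ¬ Unavoidable vec τ (𝓐.erase e)) :
    HasDenseConfig vec k k W 3 (L + 1) 𝓐 ∨ HasLongChain vec k k W L 𝓐 := by
  have hcross : ∀ e ∈ 𝓐, ∀ v ∈ (vec e).support,
      ∃ f ∈ 𝓐, (vec e).support ∩ (vec f).support = {v} := fun e he v hv => by
    obtain ⟨f, hf, -, h⟩ := exists_cross_edge hA hmin he hv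
    exact ⟨f, hf, h⟩
  obtain ⟨G₀, hG₀, -⟩ := hA fun _ => true
  have hstart : IsPath vec k W 𝓐 k [] [G₀] := by
    have hne : (vec G₀).support.Nonempty := Finset.card_pos.1 (by rw [hcard G₀ hG₀]; omega)
    obtain ⟨v, hv⟩ := hne
    refine ⟨trivial, by simpa using hG₀, ?_, G₀, [], (vec G₀).support.erase v, rfl,
      Finset.erase_subset _ _, by rw [Finset.card_erase_of_mem hv, hcard G₀ hG₀], by simp [verts]⟩
    rw [List.nil_append, weight_cons_of_not_subset]
    · simp only [weight, verts, relRank_nil, hcard G₀ hG₀]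
      simp
      linarith
    · intro h
      simpa [verts] using h hv
  rcases hstart.iterate (L := L + 1) hk (by omega) hcard hcross le_rfl (by simp) L (by simp) with
    h | h | ⟨c, hc, hp⟩
  · exact Or.inl h
  swap
  · refine Or.inr ⟨c, [G₀], hp.2.1, by simp, by simp [hc], by simp [hc], hp.1, hp.2.2.1⟩
  obtain ⟨rfl, -, G, hG, F₁, hF₁, F₂, hF₂, u, w₁, w₂, z₁, z₂, n, ht⟩ := h
  by_cases hz : z₁ = z₂
  · exact Or.inl ⟨[], [], [F₂, F₁, G], by simp [hG, hF₁, hF₂], by simp, by simp, by simp, trivial,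
      ht.weight_le.2 hz⟩
  have hT : ∀ e ∈ [F₂, F₁, G], e ∈ 𝓐 := by simp [hG, hF₁, hF₂]
  have hTtake : [F₂, F₁, G].take W = [F₂, F₁, G] := List.take_of_length_le (by simpa using hW)
  by_cases hleave : ∃ H ∈ 𝓐, ¬ (vec H).support ⊆ verts vec [F₂, F₁, G] ∧
      ((vec H).support ∩ verts vec [F₂, F₁, G]).Nonempty
  · obtain ⟨H, hH, hns, hne⟩ := hleave
    by_cases h1 : ((vec H).support ∩ verts vec [F₂, F₁, G]).card = 1
    · obtain ⟨v, hv⟩ := Finset.card_eq_one.1 h1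
      have hvT : v ∈ (vec H).support ∩ verts vec [F₂, F₁, G] := by simp [hv]
      have hp : IsPath vec 3 W 𝓐 0 [H] [F₂, F₁, G] :=
        IsPath.cons (c := []) (by simp) hcard trivial (by simpa using hT)
          (by simpa using ht.weight_le.1) hH hv
          (by rw [List.nil_append, hTtake]; exact (Finset.mem_inter.1 hvT).2)
      rcases hp.iterate (L := L + 1) hk (by omega) hcard hcross (by simp) (by simp) L
        (by simp; omega) with h | ⟨-, h, -⟩ | ⟨c, hc, hp⟩
      · exact Or.inl h
      · simp at h
      · exact Or.inr ⟨c, _, hp.2.1, by simp, by simp [hc], by simp [hc]; omega, hp.1,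
          hp.2.2.1.trans (by simp)⟩
    · left
      refine ⟨[H], [], [F₂, F₁, G], ?_, by simp, by simp, by simp, trivial, ?_⟩
      · intro e he
        rcases List.mem_cons.1 he with rfl | he
        · exact hH
        · exact hT e (by simpa using he)
      · have h2 : 2 ≤ ((vec H).support ∩ verts vec [F₂, F₁, G]).card := by
          have := Finset.card_pos.2 hne
          omega
        have h3 := weight_cons_of_card_eq (hcard H hH) hns
        have h4 := ht.weight_le.1
        simp only [List.singleton_append, List.nil_append]
        push_cast at h3
        omega
  push Not at hleave
  by_cases hin : ∃ H ∈ 𝓐, (vec H).support ⊆ verts vec [F₂, F₁, G] ∧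
      vec H ∉ relSpace vec [F₂, F₁, G]
  · obtain ⟨H, hH, hs, hnr⟩ := hin
    left
    refine ⟨[H], [], [F₂, F₁, G], ?_, by simp, by simp, by simp, trivial, ?_⟩
    · intro e he
      rcases List.mem_cons.1 he with rfl | he
      · exact hH
      · exact hT e (by simpa using he)
    · simp only [List.singleton_append, List.nil_append]
      rw [weight_cons_of_subset hs hnr]
      have h4 := ht.weight_le.1
      push_cast
      linarith
  push Not at hin
  -- the triangle is isolated, so the edges inside it can be recoloured
  exfalso
  have hmG := hmin G hG
  simp only [Unavoidable, not_forall, not_exists, not_and] at hmG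
  obtain ⟨χ, hχ⟩ := hmG
  -- Outside the triangle, `χ` defeats every edge other than `G`. Inside, every edge has three
  -- vertices, one of which is `u` or `n`. So it has a vertex coloured true, and cannot have all its
  -- vertices among these two.
  obtain ⟨H, hH, hHχ⟩ := hA fun v =>
    if v ∈ verts vec [F₂, F₁, G] then decide (v = u ∨ v = n) else χ v
  by_cases hs : (vec H).support ⊆ verts vec [F₂, F₁, G]
  · have hcol : ∀ v ∈ (vec H).support, decide (v = u ∨ v = n) = τ H := fun v hv => by
      have := hHχ v hv
      rwa [if_pos (hs hv)] at this
    have hex : ∃ v ∈ (vec H).support, v = u ∨ v = n := by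
      rcases ht.mem_support_of_mem_relSpace hz (hin H hH hs) (hcard H hH) with h | h
      · exact ⟨u, h, Or.inl rfl⟩
      · exact ⟨n, h, Or.inr rfl⟩
    obtain ⟨v, hv, hvun⟩ := hex
    have hτ : τ H = true := by rw [← hcol v hv]; simpa using hvun
    have hsub : (vec H).support ⊆ {u, n} := fun x hx => by
      have := hcol x hx
      rw [hτ] at this
      simpa using this
    have h5 := Finset.card_le_card hsub
    have h6 := Finset.card_le_two (a := u) (b := n)
    have h7 := hcard H hH
    omega
  · have hdis := hleave H hH hs
    have hout : ∀ v ∈ (vec H).support, v ∉ verts vec [F₂, F₁, G] := fun v hv hv' => by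
      have : v ∈ (vec H).support ∩ verts vec [F₂, F₁, G] := Finset.mem_inter.2 ⟨hv, hv'⟩
      simp [hdis] at this
    have hne : H ≠ G := by
      rintro rfl
      exact hs (support_subset_verts (by simp))
    obtain ⟨v, hv, hvne⟩ := hχ H (Finset.mem_erase.2 ⟨hne, hH⟩)
    have := hHχ v hv
    rw [if_neg (hout v hv)] at this
    exact hvne this

end EqualLengths

/-! ### Weights of clusters when k < l -/

section Cluster

variable {V ι : Type*} [DecidableEq V] {vec : ι → V →₀ ℚ}

/-- The edges `E u`, for `u ∈ N`, are disjoint from each other and from the vertices of `Γ`. -/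
def IsFree (vec : ι → V →₀ ℚ) (Γ : List ι) (N : Finset V) (E : V → ι) : Prop :=
  (∀ u ∈ N, Disjoint (vec (E u)).support (verts vec Γ)) ∧
    ∀ u ∈ N, ∀ u' ∈ N, u ≠ u' → Disjoint (vec (E u)).support (vec (E u')).support

/-- The vertex `u` is new to `Γ` and lies on no other edge `E u'`, so every edge raises the rank. -/
theorem relRank_map_append {E : V → ι} {Γ : List ι} {us : List V} (hnd : us.Nodup)
    (hnew : ∀ u ∈ us, u ∉ verts vec Γ) (hmem : ∀ u ∈ us, u ∈ (vec (E u)).support)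
    (hne : ∀ u ∈ us, ∀ u' ∈ us, u ≠ u' → u ∉ (vec (E u')).support) :
    relRank vec (us.map E ++ Γ) = relRank vec Γ + us.length := by
  induction us with
  | nil => simp
  | cons u us ih =>
    rw [List.nodup_cons] at hnd
    rw [List.map_cons, List.cons_append, relRank_cons_of_notMem, ih hnd.2
      (fun v hv => hnew v (by simp [hv])) (fun v hv => hmem v (by simp [hv]))
      (fun v hv v' hv' => hne v (by simp [hv]) v' (by simp [hv'])), List.length_cons, add_assoc]
    refine notMem_relSpace_of_new (hmem u (by simp)) ?_
    rw [verts_append, Finset.mem_union, not_or]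
    refine ⟨fun h => ?_, hnew u (by simp)⟩
    obtain ⟨e, he, hu⟩ := mem_verts.1 h
    obtain ⟨u', hu', rfl⟩ := List.mem_map.1 he
    exact hne u (by simp) u' (by simp [hu']) (fun huu => hnd.1 (huu ▸ hu')) (by exact hu)

/-- The effect on the weight of adding an edge `F` together with an edge through each of its new
vertices. -/
theorem cluster_weight {k l : ℕ} {Γ : List ι} {F : ι} {E : V → ι} {N : Finset V}
    (hN : N = (vec F).support \ verts vec Γ)
    (hEcard : ∀ u ∈ N, (vec (E u)).support.card = k)
    (hEF : ∀ u ∈ N, (vec F).support ∩ (vec (E u)).support = {u}) :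
    ∃ q h : ℕ, q + h ≤ N.card * (k - 1) ∧ (N.card * (k - 1) ≤ q ↔ IsFree vec Γ N E) ∧
      (h = 0 → ∀ u ∈ N, Disjoint (vec (E u)).support (verts vec Γ)) ∧
      (weight vec k l (N.toList.map E ++ F :: Γ) ≤
          weight vec k l Γ + l * (N.card + q) - k * (l - 1) * (N.card + 1) ∨
        weight vec k l (N.toList.map E ++ F :: Γ) ≤
          weight vec k l Γ + l * (N.card + q) - k * (l - 1) * N.card ∧
        2 * q + h ≤ N.card * (k - 1) ∧ (N.card ≤ 1 → q = 0)) := by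
  classical
  set X := verts vec Γ with hX
  have hNF : ∀ u ∈ N, u ∈ (vec F).support ∧ u ∉ X := fun u hu => by
    rw [hN] at hu; simpa using hu
  have hEu : ∀ u ∈ N, u ∈ (vec (E u)).support := fun u hu => by
    have : u ∈ (vec F).support ∩ (vec (E u)).support := by simp [hEF u hu]
    exact (Finset.mem_inter.1 this).2
  have hEx : ∀ u ∈ N, ∀ x ∈ (vec F).support, x ∈ (vec (E u)).support → x = u :=
    fun u hu x h1 h2 => by simpa [hEF u hu] using Finset.mem_inter.2 ⟨h1, h2⟩
  set R : V → Finset V := fun u => (vec (E u)).support.erase u with hR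
  -- `Q` is the set of new vertices that the edges `E u` bring beyond `N`, and q is its size; h
  -- counts their incidences with old vertices. Of the `N.card * (k - 1)` incidences available, h
  -- are old and the others cover `Q`. Hence q is maximal exactly when no incidence is wasted.
  set Q : Finset V := N.biUnion R \ X with hQ
  have hRF : ∀ u ∈ N, ∀ x ∈ R u, x ∉ (vec F).support := fun u hu x hx hxF => by
    rw [hR, Finset.mem_erase] at hx
    exact hx.1 (hEx u hu x hxF hx.2)
  have hRcard : ∀ u ∈ N, (R u).card = k - 1 := fun u hu => by
    rw [hR, Finset.card_erase_of_mem (hEu u hu), hEcard u hu]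
  have hsplit : ∀ u ∈ N, (R u ∩ X).card + (R u ∩ Q).card = k - 1 := fun u hu => by
    rw [← hRcard u hu, ← Finset.card_inter_add_card_sdiff (R u) X]
    congr 2
    ext x
    simp only [hQ, Finset.mem_inter, Finset.mem_sdiff, Finset.mem_biUnion]
    constructor
    · rintro ⟨h1, -, h3⟩; exact ⟨h1, h3⟩
    · rintro ⟨h1, h3⟩; exact ⟨h1, ⟨u, hu, h1⟩, h3⟩
  have hsum : ∑ u ∈ N, (R u ∩ X).card + ∑ u ∈ N, (R u ∩ Q).card = N.card * (k - 1) := by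
    rw [← Finset.sum_add_distrib, Finset.sum_congr rfl hsplit, Finset.sum_const, smul_eq_mul]
  have hdeg : ∑ u ∈ N, (R u ∩ Q).card = ∑ x ∈ Q, (N.filter fun u => x ∈ R u).card := by
    have := Finset.sum_card_bipartiteAbove_eq_sum_card_bipartiteBelow (s := N) (t := Q)
      (fun u x => x ∈ R u)
    rw [Finset.sum_congr rfl fun u _ => ?_, this]
    · rfl
    · congr 1; ext x; simp [Finset.bipartiteAbove, and_comm]
  have hdeg1 : ∀ x ∈ Q, 1 ≤ (N.filter fun u => x ∈ R u).card := fun x hx => by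
    simp only [hQ, Finset.mem_sdiff, Finset.mem_biUnion] at hx
    obtain ⟨⟨u, hu, hxu⟩, -⟩ := hx
    exact Finset.card_pos.2 ⟨u, by simp [hu, hxu]⟩
  have hqle : Q.card ≤ ∑ u ∈ N, (R u ∩ Q).card := by
    rw [hdeg, Finset.card_eq_sum_ones]
    exact Finset.sum_le_sum hdeg1
  have hdisj : ∑ u ∈ N, (R u ∩ X).card = 0 →
      ∀ u ∈ N, Disjoint (vec (E u)).support X := fun h0 u hu => by
    rw [Finset.sum_eq_zero_iff] at h0
    rw [Finset.disjoint_left]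
    intro x hx hxX
    have hxu : x ≠ u := by rintro rfl; exact (hNF x hu).2 hxX
    have hmem : x ∈ R u ∩ X := Finset.mem_inter.2 ⟨Finset.mem_erase.2 ⟨hxu, hx⟩, hxX⟩
    rw [Finset.card_eq_zero.1 (h0 u hu)] at hmem
    simp at hmem
  have hverts : (verts vec (N.toList.map E ++ F :: Γ)).card = X.card + N.card + Q.card := by
    have heq : verts vec (N.toList.map E ++ F :: Γ) = (X ∪ N) ∪ Q := by
      ext x
      rw [verts_append, Finset.mem_union, mem_verts]
      simp only [verts, Finset.mem_union, List.mem_map, Finset.mem_toList, ← hX]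
      simp only [hN, hQ, hR, Finset.mem_sdiff, Finset.mem_biUnion, Finset.mem_erase]
      constructor
      · rintro (⟨e, ⟨u, hu, rfl⟩, hx⟩ | hx | hx)
        · by_cases hxX : x ∈ X
          · exact Or.inl (Or.inl hxX)
          · by_cases hxu : x = u
            · exact Or.inl (Or.inr (hxu ▸ hu))
            · exact Or.inr ⟨⟨u, hu, hxu, hx⟩, hxX⟩
        · by_cases hxX : x ∈ X
          · exact Or.inl (Or.inl hxX)
          · exact Or.inl (Or.inr ⟨hx, hxX⟩)
        · exact Or.inl (Or.inl hx)
      · rintro ((hx | hx) | ⟨⟨u, hu, -, hx⟩, -⟩)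
        · exact Or.inr (Or.inr hx)
        · exact Or.inr (Or.inl hx.1)
        · exact Or.inl ⟨E u, ⟨u, hu, rfl⟩, hx⟩
    rw [heq, Finset.card_union_of_disjoint, Finset.card_union_of_disjoint]
    · rw [Finset.disjoint_left]; exact fun x hx hxN => (hNF x hxN).2 hx
    · rw [Finset.disjoint_left]
      intro x hx hxQ
      simp only [hQ, Finset.mem_sdiff, Finset.mem_biUnion] at hxQ
      obtain ⟨⟨u, hu, hxu⟩, hxX⟩ := hxQ
      rcases Finset.mem_union.1 hx with hx | hx
      · exact hxX hx
      · exact hRF u hu x hxu (hNF x hx).1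
  have hrank := relRank_map_append (vec := vec) (E := E) (Γ := Γ) N.nodup_toList
    (fun u hu => (hNF u (Finset.mem_toList.1 hu)).2)
    (fun u hu => hEu u (Finset.mem_toList.1 hu))
    (fun u hu u' hu' hne h => hne (hEx u' (Finset.mem_toList.1 hu') u
      (hNF u (Finset.mem_toList.1 hu)).1 h))
  rw [Finset.length_toList] at hrank
  refine ⟨Q.card, ∑ u ∈ N, (R u ∩ X).card, by omega, ⟨?_, ?_⟩, hdisj, ?_⟩
  · intro hq
    have h0 : ∑ u ∈ N, (R u ∩ X).card = 0 := by omega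
    refine ⟨hdisj h0, fun u hu u' hu' hne => ?_⟩
    rw [Finset.disjoint_left]
    intro x hx hx'
    have hxu : x ≠ u := by
      rintro rfl
      exact hne (hEx u' hu' x (hNF x hu).1 hx')
    have hxu' : x ≠ u' := by
      rintro rfl
      exact hne (hEx u hu x (hNF x hu').1 hx).symm
    have hxX : x ∉ X := Finset.disjoint_left.1 (hdisj h0 u hu) hx
    have hxR : x ∈ R u := Finset.mem_erase.2 ⟨hxu, hx⟩
    have hxR' : x ∈ R u' := Finset.mem_erase.2 ⟨hxu', hx'⟩
    have hxQ : x ∈ Q := Finset.mem_sdiff.2 ⟨Finset.mem_biUnion.2 ⟨u, hu, hxR⟩, hxX⟩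
    have hlt : Q.card < ∑ x ∈ Q, (N.filter fun u => x ∈ R u).card := by
      rw [Finset.card_eq_sum_ones]
      refine Finset.sum_lt_sum hdeg1 ⟨x, hxQ, ?_⟩
      exact Finset.one_lt_card.2 ⟨u, by simp [hu, hxR], u', by simp [hu', hxR'], hne⟩
    omega
  · rintro ⟨hf1, hf2⟩
    have h0 : ∑ u ∈ N, (R u ∩ X).card = 0 := by
      refine Finset.sum_eq_zero fun u hu => Finset.card_eq_zero.2 ?_
      exact Finset.disjoint_iff_inter_eq_empty.1
        ((hf1 u hu).mono_left (Finset.erase_subset _ _))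
    have h1 : ∑ x ∈ Q, (N.filter fun u => x ∈ R u).card ≤ Q.card := by
      rw [Finset.card_eq_sum_ones]
      refine Finset.sum_le_sum fun x _ => Finset.card_le_one.2 fun u hu u' hu' => ?_
      by_contra hne
      rw [Finset.mem_filter] at hu hu'
      exact Finset.disjoint_left.1 (hf2 u hu.1 u' hu'.1 hne) (Finset.mem_of_mem_erase hu.2)
        (Finset.mem_of_mem_erase hu'.2)
    omega
  · have hcongr : ∀ e, e ∈ N.toList.map E ++ F :: Γ ↔ e ∈ F :: (N.toList.map E ++ Γ) := fun e => by
      simp only [List.mem_append, List.mem_cons]; tauto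
    have hrk : relRank vec (N.toList.map E ++ F :: Γ) =
        relRank vec (F :: (N.toList.map E ++ Γ)) :=
      le_antisymm (relRank_mono fun e => (hcongr e).1) (relRank_mono fun e => (hcongr e).2)
    -- If `F` is dependent, one unit of rank is lost, but every vertex `x` of `Q` then lies on at
    -- least two of the `E u`: otherwise `u` and `x` would be private to `E u`, and `F` contains `u`
    -- but not `x`. This halves the bound on q.
    by_cases hF : vec F ∈ relSpace vec (N.toList.map E ++ Γ)
    · right
      have hdeg2 : ∀ x ∈ Q, 2 ≤ (N.filter fun u => x ∈ R u).card := by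
        intro x hx
        by_contra hlt
        have h1 : (N.filter fun u => x ∈ R u).card = 1 := by have := hdeg1 x hx; omega
        obtain ⟨u, hu⟩ := Finset.card_eq_one.1 h1
        have hu' : u ∈ N.filter fun u => x ∈ R u := by simp [hu]
        obtain ⟨huN, hxu⟩ := Finset.mem_filter.1 hu'
        have hxF := hRF u huN x hxu
        refine notMem_relSpace_of_private (g := E u) (w := u) (w' := x)
          (Finset.mem_of_mem_erase hxu) ?_ (hNF u huN).1 hxF hF
        intro e he hne
        rcases List.mem_append.1 he with he | he
        · obtain ⟨v, hv, rfl⟩ := List.mem_map.1 he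
          rw [Finset.mem_toList] at hv
          have hvu : v ≠ u := by rintro rfl; exact hne rfl
          refine ⟨fun h => hvu (hEx v hv u (hNF u huN).1 h).symm, fun h => hvu ?_⟩
          have hxv : x ≠ v := by rintro rfl; exact hxF (hNF x hv).1
          have : v ∈ N.filter fun u => x ∈ R u :=
            Finset.mem_filter.2 ⟨hv, Finset.mem_erase.2 ⟨hxv, h⟩⟩
          simpa [hu] using this
        · rw [hQ, Finset.mem_sdiff] at hx
          exact ⟨fun h => (hNF u huN).2 (support_subset_verts he h),
            fun h => hx.2 (support_subset_verts he h)⟩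
      refine ⟨?_, ?_, ?_⟩
      · have h1 : relRank vec (N.toList.map E ++ F :: Γ) = relRank vec Γ + N.card := by
          rw [hrk, relRank, relSpace_cons, sup_eq_right.2, ← relRank, hrank]
          simpa using hF
        rw [weight, weight, hverts, h1]
        push_cast
        linarith
      · have : 2 * Q.card ≤ ∑ x ∈ Q, (N.filter fun u => x ∈ R u).card := by
          rw [mul_comm, ← smul_eq_mul, ← Finset.sum_const]
          exact Finset.sum_le_sum hdeg2
        omega
      · intro hN1
        by_contra hq
        obtain ⟨x, hx⟩ := Finset.card_pos.1 (Nat.pos_of_ne_zero hq)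
        have := (hdeg2 x hx).trans (Finset.card_filter_le _ _)
        omega
    · left
      rw [weight, weight, hverts, hrk, relRank_cons_of_notMem hF, hrank]
      push_cast
      linarith

/-- A free cluster attached at one vertex is the balanced case. Relative to it, each extra common
vertex of `F` and `Γ` costs k, and each vertex missing from the `E u` costs l > k. When `F` is
dependent, the halved q outweighs the missing unit of rank. The final alternative says that a drop
of at most k leaves `Γ` almost untouched, so that a second cluster can be started from another
branch. -/
theorem degenerate_cluster {k l : ℕ} (hk : 3 ≤ k) (hkl : k < l) {Γ : List ι} {F : ι} {E : V → ι}
    {N : Finset V} (hN : N = (vec F).support \ verts vec Γ) (hFcard : (vec F).support.card = l)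
    (hEcard : ∀ u ∈ N, (vec (E u)).support.card = k)
    (hEF : ∀ u ∈ N, (vec F).support ∩ (vec (E u)).support = {u}) (hNne : N.Nonempty)
    (hT : ((vec F).support ∩ verts vec Γ).Nonempty) {w : ℤ}
    (hw : w = weight vec k l Γ - weight vec k l (N.toList.map E ++ F :: Γ))
    (hdeg : ¬ (((vec F).support ∩ verts vec Γ).card = 1 ∧ IsFree vec Γ N E)) :
    2 ≤ w ∧ (k = 3 ∨ k ≤ w) ∧ (k < w ∨ ((vec F).support ∩ verts vec Γ).card ≤ 2 ∧
      ∀ u ∈ N, Disjoint (vec (E u)).support (verts vec Γ)) := by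
  obtain ⟨q, h, hqh, hfree, hh, hAB⟩ := cluster_weight (l := l) hN hEcard hEF
  set t := ((vec F).support ∩ verts vec Γ).card with ht
  have hNt : N.card + t = l := by
    rw [hN, ht, ← hFcard, add_comm, Finset.card_inter_add_card_sdiff]
  have ht1 : 1 ≤ t := Finset.card_pos.2 hT
  have hN1 : 1 ≤ N.card := Finset.card_pos.2 hNne
  generalize hNc : N.card = m at *
  obtain ⟨j, rfl⟩ : ∃ j, k = j + 1 := ⟨k - 1, by omega⟩
  simp only [Nat.add_sub_cancel] at *
  have hl : (l : ℤ) = m + t := by exact_mod_cast hNt.symm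
  have hj : (2 : ℤ) ≤ j := by exact_mod_cast (by omega : 2 ≤ j)
  have hjl : (j : ℤ) + 2 ≤ l := by exact_mod_cast (by omega : j + 2 ≤ l)
  have ht1' : (1 : ℤ) ≤ t := by exact_mod_cast ht1
  have hm1' : (1 : ℤ) ≤ m := by exact_mod_cast hN1
  have hqh' : (q : ℤ) + h ≤ m * j := by exact_mod_cast hqh
  have hh0 : (0 : ℤ) ≤ h := by positivity
  push_cast at hAB ⊢
  rcases hAB with hA | ⟨hB, hB2, hB1⟩
  · by_cases hq : m * j ≤ q
    · have hf := hfree.1 hq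
      have ht2 : 2 ≤ t := by
        by_contra hlt
        exact hdeg ⟨by omega, hf⟩
      have ht2' : (2 : ℤ) ≤ t := by exact_mod_cast ht2
      have hqe : (q : ℤ) = m * j := by
        have : (m : ℤ) * j ≤ q := by exact_mod_cast hq
        linarith
      have hge : (j + 1) * ((t : ℤ) - 1) ≤ w := by
        rw [hw]; rw [hqe] at hA
        have : (m : ℤ) = l - t := by linarith
        rw [this] at hA
        nlinarith
      have hge1 : (j : ℤ) + 1 ≤ w := by nlinarith
      refine ⟨by linarith, Or.inr hge1, ?_⟩
      by_cases ht3 : t ≤ 2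
      · exact Or.inr ⟨ht3, hf.1⟩
      · have : (3 : ℤ) ≤ t := by exact_mod_cast (by omega : 3 ≤ t)
        left; nlinarith
    · have hq' : (q : ℤ) + 1 ≤ m * j := by exact_mod_cast (by omega : q + 1 ≤ m * j)
      have hge : (l : ℤ) ≤ w := by
        have h1 : (j + 1) * ((t : ℤ) - 1) + l * (m * j - q) ≤ w := by
          have : (m : ℤ) = l - t := by linarith
          rw [hw]; rw [this] at hA ⊢
          nlinarith
        have h2 : (l : ℤ) ≤ l * (m * j - q) := by nlinarith
        have h3 : 0 ≤ (j + 1) * ((t : ℤ) - 1) := mul_nonneg (by linarith) (by linarith)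
        linarith
      exact ⟨by linarith, Or.inr (by linarith), Or.inl (by linarith)⟩
  · have hB2' : 2 * (q : ℤ) + h ≤ m * j := by exact_mod_cast hB2
    by_cases hm : m ≤ 1
    · have hm' : (m : ℤ) = 1 := by exact_mod_cast (by omega : m = 1)
      rw [hB1 hm, hm'] at hB
      have : (j : ℤ) + 1 < w := by
        have h1 : 0 ≤ ((j : ℤ) - 2) * (l - 2) := mul_nonneg (by linarith) (by linarith)
        rw [hw]
        push_cast at hB
        linarith
      exact ⟨by linarith, Or.inr this.le, Or.inl this⟩
    · have hm2 : (2 : ℤ) ≤ m := by exact_mod_cast (by omega : 2 ≤ m)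
      have h2w : (m : ℤ) * (j * (l - 2) - 2) + l * h ≤ 2 * w := by
        have h1 : l * (2 * (q : ℤ) + h) ≤ l * (m * j) :=
          mul_le_mul_of_nonneg_left hB2' (by linarith)
        rw [hw]
        linarith
      have hM : (2 : ℤ) ≤ j * (l - 2) - 2 := by
        have h1 : 0 ≤ ((j : ℤ) - 2) * (l - 2) := mul_nonneg (by linarith) (by linarith)
        linarith
      have h3 : 2 * ((j : ℤ) * (l - 2) - 2) + l * h ≤ 2 * w := by
        have h1 := mul_le_mul_of_nonneg_right hm2 (by linarith : (0 : ℤ) ≤ j * (l - 2) - 2)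
        linarith
      -- With k = j + 1, the pair (k, l) = (3, 4) is the only one for which j(l-2) - 2 does not
      -- exceed k; here the drop may be as small as 2. Since at least two vertices of `F` are new,
      -- at most two are old.
      by_cases hspec : j = 2 ∧ l = 4
      · obtain ⟨rfl, rfl⟩ := hspec
        push_cast at h3 ⊢
        refine ⟨by linarith, Or.inl trivial, ?_⟩
        rcases Nat.eq_zero_or_pos h with h0 | h0
        · exact Or.inr ⟨by omega, hh h0⟩
        · have : (1 : ℤ) ≤ h := by exact_mod_cast h0
          left; linarith
      · have hbig : (j : ℤ) + 1 < j * (l - 2) - 2 := by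
          by_cases hj2 : j = 2
          · have : (5 : ℤ) ≤ l := by exact_mod_cast (by omega : 5 ≤ l)
            rw [hj2]; push_cast; linarith
          · have : (3 : ℤ) ≤ j := by exact_mod_cast (by omega : 3 ≤ j)
            have h1 : 0 ≤ ((j : ℤ) - 3) * (l - 2) := mul_nonneg (by linarith) (by linarith)
            linarith
        have hlh : 0 ≤ (l : ℤ) * h := by positivity
        exact ⟨by linarith, Or.inr (by linarith), Or.inl (by linarith)⟩

/-- The cluster has (l-1)k new vertices and l new relations, so the gain l(l-1)k equals the cost
k(l-1)l. A dependent `F` is ruled out because q is maximal. -/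
theorem free_cluster_weight {k l : ℕ} (hk : 3 ≤ k) {Γ : List ι} {F : ι} {E : V → ι}
    {N : Finset V} (hN : N = (vec F).support \ verts vec Γ) (hFcard : (vec F).support.card = l)
    (hEcard : ∀ u ∈ N, (vec (E u)).support.card = k)
    (hEF : ∀ u ∈ N, (vec F).support ∩ (vec (E u)).support = {u}) (hNne : N.Nonempty)
    (hT : ((vec F).support ∩ verts vec Γ).card = 1) (hfree : IsFree vec Γ N E) :
    weight vec k l (N.toList.map E ++ F :: Γ) ≤ weight vec k l Γ := by
  obtain ⟨q, h, hqh, hfr, hh, hAB⟩ := cluster_weight (l := l) hN hEcard hEF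
  have hNt : N.card + 1 = l := by
    rw [hN, ← hT, ← hFcard, add_comm, Finset.card_inter_add_card_sdiff]
  have hN1 : 1 ≤ N.card := Finset.card_pos.2 hNne
  have hq := hfr.2 hfree
  generalize N.card = m at *
  obtain ⟨j, rfl⟩ : ∃ j, k = j + 1 := ⟨k - 1, by omega⟩
  simp only [Nat.add_sub_cancel] at *
  have hmj : 1 ≤ m * j := Nat.mul_pos hN1 (by omega)
  rcases hAB with hA | ⟨-, hB, -⟩
  · have hqe : (q : ℤ) = m * j := by exact_mod_cast (by omega : q = m * j)
    have hl : (l : ℤ) = m + 1 := by exact_mod_cast hNt.symm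
    rw [hqe, hl] at hA
    rw [hl] at *
    push_cast at hA
    linarith
  · omega

/-- With lk vertices and rank l + 1 the weight is l²k - k(l²-1) = k. One lost vertex costs l > k,
and a dependent `F` makes the weight negative as well. -/
theorem initial_cluster_weight {k l : ℕ} (hk : 3 ≤ k) (hkl : k < l) {F : ι} {E : V → ι}
    (hFcard : (vec F).support.card = l)
    (hEcard : ∀ u ∈ (vec F).support, (vec (E u)).support.card = k)
    (hEF : ∀ u ∈ (vec F).support, (vec F).support ∩ (vec (E u)).support = {u}) :
    weight vec k l ((vec F).support.toList.map E ++ [F]) < 0 ∨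
      weight vec k l ((vec F).support.toList.map E ++ [F]) ≤ k ∧
        IsFree vec [] (vec F).support E := by
  obtain ⟨q, h, hqh, hfr, hh, hAB⟩ := cluster_weight (l := l) (Γ := []) (E := E)
    (N := (vec F).support) (F := F) (by simp [verts]) hEcard hEF
  rw [hFcard] at hqh hfr hAB
  obtain ⟨j, rfl⟩ : ∃ j, k = j + 1 := ⟨k - 1, by omega⟩
  simp only [Nat.add_sub_cancel] at *
  have h0 : weight vec (j + 1) l [] = 0 := by simp [weight, verts, relRank_nil]
  rw [h0] at hAB
  have hj : (2 : ℤ) ≤ j := by exact_mod_cast (by omega : 2 ≤ j)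
  have hjl : (j : ℤ) + 2 ≤ l := by exact_mod_cast (by omega : j + 2 ≤ l)
  have hh0 : (0 : ℤ) ≤ h := by positivity
  push_cast at hAB ⊢
  rcases hAB with hA | ⟨hB, hB2, -⟩
  · by_cases hq : l * j ≤ q
    · right
      have hqe : (q : ℤ) = l * j := by exact_mod_cast (by omega : q = l * j)
      rw [hqe] at hA
      exact ⟨by linarith, hfr.1 hq⟩
    · left
      have hq' : (q : ℤ) + 1 ≤ l * j := by exact_mod_cast (by omega : q + 1 ≤ l * j)
      have h1 := mul_le_mul_of_nonneg_left hq' (by linarith : (0 : ℤ) ≤ l)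
      linarith
  · left
    have hB2' : 2 * (q : ℤ) + h ≤ l * j := by exact_mod_cast hB2
    have h1 := mul_le_mul_of_nonneg_left hB2' (by linarith : (0 : ℤ) ≤ l)
    have h2 : 0 ≤ (l : ℤ) * h := mul_nonneg (by linarith) hh0
    have h3 : 0 ≤ (l : ℤ) * (((j : ℤ) - 2) * (l - 2)) :=
      mul_nonneg (by linarith) (mul_nonneg (by linarith) (by linarith))
    have h4 : 0 ≤ ((l : ℤ) - 4) * l := mul_nonneg (by linarith) (by linarith)
    linarith

end Cluster

/-! ### Exploration when k < l -/

section UnequalLengths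

variable {V ι : Type*} [DecidableEq V] {vec : ι → V →₀ ℚ}

theorem mem_take_append {α : Type*} {a : α} {s t : List α} {W : ℕ} (ha : a ∈ s)
    (hs : s.length ≤ W) : a ∈ (s ++ t).take W := by
  rw [List.take_append, List.take_of_length_le hs]
  exact List.mem_append_left _ ha

/-- All branches hang on `F`. When the last one is attached, `us.length - 1` edges precede `F`, so
the window still contains it. -/
theorem IsFree.isLocalChain {W : ℕ} {Γ : List ι} {F : ι} {E : V → ι} {N : Finset V}
    (hNF : N ⊆ (vec F).support)
    (hEF : ∀ u ∈ N, (vec F).support ∩ (vec (E u)).support = {u}) (hfree : IsFree vec Γ N E)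
    {us : List V} (hus : ∀ u ∈ us, u ∈ N) (hnd : us.Nodup) (hW : us.length ≤ W) :
    IsLocalChain vec W (us.map E) (F :: Γ) := by
  induction us with
  | nil => trivial
  | cons u us ih =>
    rw [List.nodup_cons] at hnd
    rw [List.length_cons] at hW
    have huN : u ∈ N := hus u (by simp)
    have huF : u ∈ (vec F).support ∩ (vec (E u)).support := by simp [hEF u huN]
    refine ⟨⟨u, ?_, ?_⟩, ih (fun v hv => hus v (by simp [hv])) hnd.2 (by omega)⟩
    · ext x
      rw [Finset.mem_inter, verts_append, Finset.mem_union, Finset.mem_singleton]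
      simp only [verts, Finset.mem_union]
      constructor
      · rintro ⟨hx, hx' | hx' | hx'⟩
        · obtain ⟨e, he, hxe⟩ := mem_verts.1 hx'
          obtain ⟨u', hu', rfl⟩ := List.mem_map.1 he
          have hne : u ≠ u' := by rintro rfl; exact hnd.1 hu'
          exact absurd hxe (Finset.disjoint_left.1
            (hfree.2 u huN u' (hus u' (by simp [hu'])) hne) hx)
        · have : x ∈ (vec F).support ∩ (vec (E u)).support := Finset.mem_inter.2 ⟨hx', hx⟩
          simpa [hEF u huN] using this
        · exact absurd hx' (Finset.disjoint_left.1 (hfree.1 u huN) hx)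
      · rintro rfl
        exact ⟨(Finset.mem_inter.1 huF).2, Or.inr (Or.inl (hNF huN))⟩
    · refine mem_verts.2 ⟨F, ?_, hNF huN⟩
      have := mem_take_append (a := F) (s := us.map E ++ [F]) (t := Γ) (W := W) (by simp)
        (by simpa using hW)
      simpa using this

/-- The list `Γ` ends in at least three edges of size `k` that have private vertices. -/
def HasBranches (vec : ι → V →₀ ℚ) (τ : ι → Bool) (W : ℕ) (Γ : List ι) : Prop :=
  ∃ 𝓑 : Finset ι, 3 ≤ 𝓑.card ∧ ∀ B ∈ 𝓑, τ B = false ∧ B ∈ Γ.take W ∧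
    ∃ P ⊆ (vec B).support, 2 ≤ P.card ∧ ∀ e ∈ Γ, e ≠ B → Disjoint P (vec e).support

theorem IsFree.hasBranches {k W : ℕ} (hk : 3 ≤ k) {τ : ι → Bool} {Γ : List ι} {F : ι} {E : V → ι}
    {N : Finset V} (hN3 : 3 ≤ N.card) (hNW : N.card ≤ W)
    (hEcard : ∀ u ∈ N, (vec (E u)).support.card = k) (hτ : ∀ u ∈ N, τ (E u) = false)
    (hNF : N ⊆ (vec F).support)
    (hEF : ∀ u ∈ N, (vec F).support ∩ (vec (E u)).support = {u}) (hfree : IsFree vec Γ N E) :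
    HasBranches vec τ W (N.toList.map E ++ F :: Γ) := by
  classical
  have hEu : ∀ u ∈ N, u ∈ (vec (E u)).support := fun u hu => by
    have : u ∈ (vec F).support ∩ (vec (E u)).support := by simp [hEF u hu]
    exact (Finset.mem_inter.1 this).2
  refine ⟨N.image E, ?_, ?_⟩
  · rw [Finset.card_image_of_injOn]
    · exact hN3
    · intro u hu u' hu' h
      have hu' : u ∈ (vec F).support ∩ (vec (E u')).support :=
        Finset.mem_inter.2 ⟨hNF hu, by rw [← show E u = E u' from h]; exact hEu u hu⟩
      rw [hEF u' (by assumption)] at hu'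
      simpa using hu'
  · intro B hB
    obtain ⟨u, hu, rfl⟩ := Finset.mem_image.1 hB
    refine ⟨hτ u hu, mem_take_append (List.mem_map.2 ⟨u, by simpa using hu, rfl⟩) (by simpa),
      (vec (E u)).support.erase u, Finset.erase_subset _ _, ?_, ?_⟩
    · rw [Finset.card_erase_of_mem (hEu u hu), hEcard u hu]; omega
    · intro e he hne
      rcases List.mem_append.1 he with he | he
      · obtain ⟨u', hu', rfl⟩ := List.mem_map.1 he
        exact (hfree.2 u hu u' (by simpa using hu') (by rintro rfl; exact hne rfl)).mono_left
          (Finset.erase_subset _ _)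
      · rcases List.mem_cons.1 he with rfl | he
        · rw [Finset.disjoint_left]
          intro x hx hx'
          have : x ∈ (vec e).support ∩ (vec (E u)).support :=
            Finset.mem_inter.2 ⟨hx', Finset.mem_of_mem_erase hx⟩
          rw [hEF u hu, Finset.mem_singleton] at this
          exact Finset.ne_of_mem_erase hx this
        · exact ((hfree.1 u hu).mono_left (Finset.erase_subset _ _)).mono_right
            (support_subset_verts he)

/-- One step of the exploration of a core whose edges have different sizes. -/
theorem cluster_extend {k l W : ℕ} (hk : 3 ≤ k) (hkl : k < l) {τ : ι → Bool} {𝓐 : Finset ι}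
    (hcard : ∀ e ∈ 𝓐, (vec e).support.card = if τ e then l else k)
    (hcross : ∀ e ∈ 𝓐, ∀ v ∈ (vec e).support,
      ∃ f ∈ 𝓐, τ f ≠ τ e ∧ (vec e).support ∩ (vec f).support = {v})
    {Γ : List ι} (hΓ : ∀ e ∈ Γ, e ∈ 𝓐) (hbr : HasBranches vec τ W Γ)
    (hw : weight vec k l Γ ≤ k) :
    (∃ F ∈ 𝓐, τ F = true ∧ ∃ v ∈ verts vec (Γ.take W), (vec F).support ∩ verts vec Γ = {v} ∧
      ∃ E : V → ι, (∀ u ∈ (vec F).support, E u ∈ 𝓐 ∧ τ (E u) = false ∧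
        (vec F).support ∩ (vec (E u)).support = {u}) ∧
        IsFree vec Γ ((vec F).support \ verts vec Γ) E) ∨
    (∃ t : List ι, t.length ≤ 2 * l + 2 ∧ (∀ e ∈ t, e ∈ 𝓐) ∧ weight vec k l (t ++ Γ) < 0) := by
  by_contra hcon
  push Not at hcon
  obtain ⟨hext, hdense⟩ := hcon
  obtain ⟨𝓑, hB3, hB⟩ := hbr
  have hkz : (3 : ℤ) ≤ k := by exact_mod_cast hk
  have hklz : (k : ℤ) + 1 ≤ l := by exact_mod_cast hkl
  have hneg : (k : ℤ) - k * (l - 1) < 0 := by nlinarith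
  have hB𝓐 : ∀ B ∈ 𝓑, B ∈ Γ := fun B h => List.mem_of_mem_take (hB B h).2.1
  have htrue : ∀ {e f : ι}, τ e = false → τ f ≠ τ e → τ f = true := fun h1 h2 => by
    rw [h1] at h2; simpa using h2
  -- the cluster at an edge
  have hcl : ∀ F ∈ 𝓐, τ F = true → ∃ E : V → ι, ∀ u ∈ (vec F).support, E u ∈ 𝓐 ∧
      τ (E u) = false ∧ (vec F).support ∩ (vec (E u)).support = {u} := by
    intro F hF hτ
    have : Nonempty ι := ⟨F⟩
    choose! E hE using hcross F hF
    refine ⟨E, fun u hu => ⟨(hE u hu).1, ?_, (hE u hu).2.2⟩⟩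
    have := (hE u hu).2.1
    rw [hτ] at this
    simpa using this
  have hinter : ∀ {B F : ι} {w : V}, (vec B).support ∩ (vec F).support = {w} →
      w ∈ (vec B).support ∧ w ∈ (vec F).support ∧
        ∀ x ∈ (vec B).support, x ∈ (vec F).support → x = w := fun {B F w} h => by
    have h1 : w ∈ (vec B).support ∩ (vec F).support := by simp [h]
    refine ⟨(Finset.mem_inter.1 h1).1, (Finset.mem_inter.1 h1).2, fun x h2 h3 => ?_⟩
    simpa [h] using Finset.mem_inter.2 ⟨h2, h3⟩
  -- a crossing edge with no new vertices is independent
  have hold : ∀ (t : List ι), t.length ≤ l + 1 → (∀ e ∈ t, e ∈ 𝓐) →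
      weight vec k l (t ++ Γ) ≤ k → ∀ B ∈ 𝓑, ∀ P ⊆ (vec B).support,
      (∀ e ∈ t ++ Γ, e ≠ B → Disjoint P (vec e).support) → ∀ w ∈ P, ∀ w' ∈ P, w ≠ w' →
      ∀ F ∈ 𝓐, (vec B).support ∩ (vec F).support = {w} →
      ¬ (vec F).support ⊆ verts vec (t ++ Γ) := by
    intro t ht htA hwt B hBB P hP hPd w hw w' hw' hne F hF hBF hsub
    obtain ⟨-, hwF, huniq⟩ := hinter hBF
    have hnm : vec F ∉ relSpace vec (t ++ Γ) := by
      refine notMem_relSpace_of_private (g := B) (w := w) (w' := w') (hP hw') ?_ hwF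
        (fun h => hne (huniq w' (hP hw') h).symm)
      intro e he heB
      exact ⟨Finset.disjoint_left.1 (hPd e he heB) hw, Finset.disjoint_left.1 (hPd e he heB) hw'⟩
    have := hdense (F :: t) (by simp; omega) (by
      intro e he
      rcases List.mem_cons.1 he with rfl | he
      · exact hF
      · exact htA e he)
    rw [List.cons_append, weight_cons_of_subset hsub hnm] at this
    linarith
  -- a crossing edge with new vertices starts a degenerate cluster
  have hnew : ∀ (t : List ι), ∀ B ∈ 𝓑, ∀ w, ∀ F ∈ 𝓐, τ F = true →
      (vec B).support ∩ (vec F).support = {w} → ¬ (vec F).support ⊆ verts vec (t ++ Γ) →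
      ∃ E : V → ι, ∃ N : Finset V, N.card ≤ l ∧ (∀ u ∈ N, E u ∈ 𝓐) ∧
        ∃ d : ℤ, weight vec k l (N.toList.map E ++ F :: (t ++ Γ)) = weight vec k l (t ++ Γ) - d ∧
        2 ≤ d ∧ (k = 3 ∨ k ≤ d) ∧ (k < d ∨ ((vec F).support ∩ verts vec (t ++ Γ)).card ≤ 2 ∧
          ∀ u ∈ N, Disjoint (vec (E u)).support (verts vec (t ++ Γ))) := by
    intro t B hBB w F hF hτF hBF hns
    obtain ⟨hτB, hBW, -⟩ := hB B hBB
    obtain ⟨hwB, hwF, -⟩ := hinter hBF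
    have hwΓ : w ∈ verts vec Γ := support_subset_verts (hB𝓐 B hBB) hwB
    have hsubΓ : verts vec Γ ⊆ verts vec (t ++ Γ) := verts_mono fun e he => by simp [he]
    obtain ⟨E, hE⟩ := hcl F hF hτF
    have hFcard : (vec F).support.card = l := by rw [hcard F hF, if_pos hτF]
    have hNF : (vec F).support \ verts vec (t ++ Γ) ⊆ (vec F).support := Finset.sdiff_subset
    refine ⟨E, (vec F).support \ verts vec (t ++ Γ), ?_, fun u hu => (hE u (hNF hu)).1,
      weight vec k l (t ++ Γ) - weight vec k l
        (((vec F).support \ verts vec (t ++ Γ)).toList.map E ++ F :: (t ++ Γ)), by ring, ?_⟩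
    · rw [← hFcard]; exact Finset.card_le_card hNF
    refine degenerate_cluster hk hkl rfl hFcard ?_ (fun u hu => (hE u (hNF hu)).2.2)
      (Finset.sdiff_nonempty.2 hns) ⟨w, Finset.mem_inter.2 ⟨hwF, hsubΓ hwΓ⟩⟩ rfl ?_
    · intro u hu
      rw [hcard _ (hE u (hNF hu)).1, (hE u (hNF hu)).2.1]
      simp
    -- A cluster that is free over `t ++ Γ` and meets it only in `w` is free over `Γ` too, and would
    -- be an extension of the kind excluded by `hext`.
    · rintro ⟨hT1, hfree⟩
      have hTw : (vec F).support ∩ verts vec (t ++ Γ) = {w} := by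
        symm
        apply Finset.eq_of_subset_of_card_le
        · simpa using ⟨Finsupp.mem_support_iff.1 hwF, hsubΓ hwΓ⟩
        · simp [hT1]
      have hTw' : (vec F).support ∩ verts vec Γ = {w} := by
        apply Finset.Subset.antisymm
        · rw [← hTw]; exact Finset.inter_subset_inter_left hsubΓ
        · simpa using ⟨Finsupp.mem_support_iff.1 hwF, hwΓ⟩
      have hNeq : (vec F).support \ verts vec (t ++ Γ) = (vec F).support \ verts vec Γ := by
        rw [← Finset.sdiff_inter_self_left, hTw, ← hTw', Finset.sdiff_inter_self_left]
      rw [hNeq] at hfree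
      exact hext F hF hτF w (support_subset_verts hBW hwB) hTw' E hE
        ⟨fun u hu => (hfree.1 u hu).mono_right hsubΓ, hfree.2⟩
  classical
  -- the first cluster
  obtain ⟨a, ha⟩ := Finset.card_pos.1 (by omega : 0 < 𝓑.card)
  obtain ⟨hτa, -, P, hP, hP2, hPd⟩ := hB a ha
  obtain ⟨w₁, hw₁, w₁', hw₁', hne₁⟩ := Finset.one_lt_card.1 (by omega : 1 < P.card)
  obtain ⟨F₁, hF₁, hτF₁, haF₁⟩ := hcross a (hΓ a (hB𝓐 a ha)) w₁ (hP hw₁)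
  have hns₁ := hold [] (by simp) (by simp) hw a ha P hP hPd w₁ hw₁ w₁' hw₁' hne₁ F₁ hF₁ haF₁
  obtain ⟨E₁, N₁, hN₁, hE₁, d₁, hwt₁, hd₁, hkd₁, hor₁⟩ :=
    hnew [] a ha w₁ F₁ hF₁ (htrue hτa hτF₁) haF₁ hns₁
  simp only [List.nil_append] at hwt₁ hor₁
  set t₁ : List ι := N₁.toList.map E₁ ++ [F₁] with ht₁
  have hΓ₁ : t₁ ++ Γ = N₁.toList.map E₁ ++ F₁ :: Γ := by simp [ht₁]
  have ht₁len : t₁.length ≤ l + 1 := by simpa [ht₁] using hN₁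
  have ht₁A : ∀ e ∈ t₁, e ∈ 𝓐 := by
    intro e he
    rcases List.mem_append.1 he with he | he
    · obtain ⟨u, hu, rfl⟩ := List.mem_map.1 he
      exact hE₁ u (by simpa using hu)
    · rw [List.mem_singleton.1 he]; exact hF₁
  have hpos₁ := hdense t₁ (by omega) ht₁A
  rw [← hΓ₁] at hwt₁
  -- The weight was at most k and is still non-negative, so d₁ ≤ k. Thus `F₁` contains at most one
  -- vertex of `Γ` besides `w₁`. This is why three branches are required: one of the other two is
  -- missed.
  obtain ⟨hT₁, hdis₁⟩ := hor₁.resolve_left (by linarith)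
  -- a branch avoiding the first cluster
  obtain ⟨b, hb, Pb, hPb, hPb2, hPbd, hPbF⟩ : ∃ b ∈ 𝓑, ∃ Pb ⊆ (vec b).support, 2 ≤ Pb.card ∧
      (∀ e ∈ Γ, e ≠ b → Disjoint Pb (vec e).support) ∧ Disjoint Pb (vec F₁).support := by
    by_contra hall
    push Not at hall
    obtain ⟨b₁, hb₁, b₂, hb₂, hbne⟩ := Finset.one_lt_card.1
      (by rw [Finset.card_erase_of_mem ha]; omega : 1 < (𝓑.erase a).card)
    rw [Finset.mem_erase] at hb₁ hb₂
    obtain ⟨-, -, P₁, hP₁, hP₁2, hP₁d⟩ := hB b₁ hb₁.2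
    obtain ⟨-, -, P₂, hP₂, hP₂2, hP₂d⟩ := hB b₂ hb₂.2
    obtain ⟨x₁, hx₁, hx₁F⟩ := Finset.not_disjoint_iff.1 (hall b₁ hb₁.2 P₁ hP₁ hP₁2 hP₁d)
    obtain ⟨x₂, hx₂, hx₂F⟩ := Finset.not_disjoint_iff.1 (hall b₂ hb₂.2 P₂ hP₂ hP₂2 hP₂d)
    have h1 : w₁ ≠ x₁ := by
      rintro rfl
      exact Finset.disjoint_left.1 (hP₁d a (hB𝓐 a ha) hb₁.1.symm) hx₁ (hP hw₁)
    have h2 : w₁ ≠ x₂ := by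
      rintro rfl
      exact Finset.disjoint_left.1 (hP₂d a (hB𝓐 a ha) hb₂.1.symm) hx₂ (hP hw₁)
    have h3 : x₁ ≠ x₂ := by
      rintro rfl
      exact Finset.disjoint_left.1 (hP₁d b₂ (hB𝓐 b₂ hb₂.2) hbne.symm) hx₁ (hP₂ hx₂)
    have hsub : ({w₁, x₁, x₂} : Finset V) ⊆ (vec F₁).support ∩ verts vec Γ := by
      intro x hx
      simp only [Finset.mem_insert, Finset.mem_singleton] at hx
      rw [Finset.mem_inter]
      rcases hx with rfl | rfl | rfl
      · exact ⟨(hinter haF₁).2.1, support_subset_verts (hB𝓐 a ha) (hP hw₁)⟩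
      · exact ⟨hx₁F, support_subset_verts (hB𝓐 b₁ hb₁.2) (hP₁ hx₁)⟩
      · exact ⟨hx₂F, support_subset_verts (hB𝓐 b₂ hb₂.2) (hP₂ hx₂)⟩
    have := Finset.card_le_card hsub
    rw [Finset.card_eq_three.2 ⟨w₁, x₁, x₂, h1, h2, h3, rfl⟩] at this
    omega
  have hPbΓ : Pb ⊆ verts vec Γ := hPb.trans (support_subset_verts (hB𝓐 b hb))
  have hPbd₁ : ∀ e ∈ t₁ ++ Γ, e ≠ b → Disjoint Pb (vec e).support := by
    intro e he hne
    rcases List.mem_append.1 he with he | he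
    · rcases List.mem_append.1 he with he | he
      · obtain ⟨u, hu, rfl⟩ := List.mem_map.1 he
        exact ((hdis₁ u (by simpa using hu)).mono_right hPbΓ).symm
      · rw [List.mem_singleton.1 he]; exact hPbF
    · exact hPbd e he hne
  -- the second cluster
  obtain ⟨w₂, hw₂, w₂', hw₂', hne₂⟩ := Finset.one_lt_card.1 (by omega : 1 < Pb.card)
  obtain ⟨F₂, hF₂, hτF₂, hbF₂⟩ := hcross b (hΓ b (hB𝓐 b hb)) w₂ (hPb hw₂)
  have hns₂ := hold t₁ ht₁len ht₁A (by linarith) b hb Pb hPb hPbd₁ w₂ hw₂ w₂' hw₂' hne₂ F₂ hF₂ hbF₂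
  obtain ⟨E₂, N₂, hN₂, hE₂, d₂, hwt₂, hd₂, -, -⟩ :=
    hnew t₁ b hb w₂ F₂ hF₂ (htrue (hB b hb).1 hτF₂) hbF₂ hns₂
  have hpos₂ := hdense (N₂.toList.map E₂ ++ F₂ :: t₁) (by simp; omega) (by
    intro e he
    rcases List.mem_append.1 he with he | he
    · obtain ⟨u, hu, rfl⟩ := List.mem_map.1 he
      exact hE₂ u (by simpa using hu)
    · rcases List.mem_cons.1 he with rfl | he
      · exact hF₂
      · exact ht₁A e he)
  rw [List.append_assoc, List.cons_append, hwt₂] at hpos₂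
  -- Two drops exhaust the initial weight: 2 + 2 > 3 if k = 3, and k + 2 > k otherwise.
  rcases hkd₁ with h3 | hkd
  · have : (k : ℤ) = 3 := by exact_mod_cast h3
    linarith
  · linarith

/-- The chain grows by whole free clusters of l edges, hence the overshoot of at most l beyond L.
The l - 1 ≥ 3 branches of the newest cluster are the starting points for the next one. -/
theorem dense_or_long_of_lt [DecidableEq ι] {k l W L : ℕ} (hk : 3 ≤ k) (hkl : k < l) (hW : l ≤ W)
    {τ : ι → Bool} {𝓐 : Finset ι} (hcard : ∀ e ∈ 𝓐, (vec e).support.card = if τ e then l else k)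
    (hA : Unavoidable vec τ 𝓐) (hmin : ∀ e ∈ 𝓐, ¬ Unavoidable vec τ (𝓐.erase e)) :
    HasDenseConfig vec k l W (2 * l + 2) (L + l) 𝓐 ∨ HasLongChain vec k l W L 𝓐 := by
  have hcross : ∀ e ∈ 𝓐, ∀ v ∈ (vec e).support,
      ∃ f ∈ 𝓐, τ f ≠ τ e ∧ (vec e).support ∩ (vec f).support = {v} :=
    fun e he v hv => exists_cross_edge hA hmin he hv
  suffices h : ∀ m, HasDenseConfig vec k l W (2 * l + 2) (L + l) 𝓐 ∨
      ∃ c h : List ι, (∀ e ∈ c ++ h, e ∈ 𝓐) ∧ h.length ≤ 3 ∧ c.length ≤ L + l ∧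
        (L ≤ c.length ∨ m ≤ c.length) ∧ IsLocalChain vec W c h ∧ weight vec k l (c ++ h) ≤ k ∧
        HasBranches vec τ W (c ++ h) by
    rcases h L with h | ⟨c, h, h1, h2, h3, h4, h5, h6, -⟩
    · exact Or.inl h
    · exact Or.inr ⟨c, h, h1, h2, by omega, h3, h5, h6⟩
  intro m
  induction m with
  | zero =>
    obtain ⟨F, hF, hτF⟩ : ∃ F ∈ 𝓐, τ F = true := by
      obtain ⟨e, he, -⟩ := hA fun _ => true
      by_cases hτ : τ e = true
      · exact ⟨e, he, hτ⟩
      · have hne : (vec e).support.Nonempty := Finset.card_pos.1 (by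
          rw [hcard e he, if_neg hτ]; omega)
        obtain ⟨v, hv⟩ := hne
        obtain ⟨f, hf, hτf, -⟩ := hcross e he v hv
        refine ⟨f, hf, ?_⟩
        rw [Bool.not_eq_true] at hτ
        rw [hτ] at hτf
        simpa using hτf
    have hFcard : (vec F).support.card = l := by rw [hcard F hF, if_pos hτF]
    have : Nonempty ι := ⟨F⟩
    choose! E hE using hcross F hF
    have hτE : ∀ u ∈ (vec F).support, τ (E u) = false := fun u hu => by
      have := (hE u hu).2.1
      rw [hτF] at this
      simpa using this
    have hEcard : ∀ u ∈ (vec F).support, (vec (E u)).support.card = k := fun u hu => by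
      rw [hcard _ (hE u hu).1, hτE u hu]; simp
    have hmem : ∀ e ∈ (vec F).support.toList.map E ++ [F], e ∈ 𝓐 := by
      intro e he
      rcases List.mem_append.1 he with he | he
      · obtain ⟨u, hu, rfl⟩ := List.mem_map.1 he
        exact (hE u (by simpa using hu)).1
      · rw [List.mem_singleton.1 he]; exact hF
    have hEF : ∀ u ∈ (vec F).support, (vec F).support ∩ (vec (E u)).support = {u} :=
      fun u hu => (hE u hu).2.2
    have hlen : ((vec F).support.toList.map E).length = l := by simp [hFcard]
    rcases initial_cluster_weight hk hkl hFcard hEcard hEF with hneg | ⟨hle, hfree⟩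
    · refine Or.inl ⟨(vec F).support.toList.map E ++ [F], [], [], ?_, by simp, ?_, by simp,
        trivial, ?_⟩
      · simpa using hmem
      · rw [List.length_append, hlen]; simp; omega
      · simpa using hneg
    · refine Or.inr ⟨(vec F).support.toList.map E, [F], hmem, by simp, by omega,
        Or.inr (Nat.zero_le _), ?_, hle, ?_⟩
      · exact hfree.isLocalChain subset_rfl hEF (fun u hu => by simpa using hu)
          (Finset.nodup_toList _) (by rw [Finset.length_toList]; omega)
      · exact hfree.hasBranches hk (by omega) (by omega) hEcard hτE subset_rfl hEF
  | succ m ih =>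
    rcases ih with ih | ⟨c, h, hmem, hh, hcL, hor, hchain, hw, hbr⟩
    · exact Or.inl ih
    by_cases hL : L ≤ c.length
    · exact Or.inr ⟨c, h, hmem, hh, hcL, Or.inl hL, hchain, hw, hbr⟩
    have hm := hor.resolve_left hL
    rcases cluster_extend hk hkl hcard hcross hmem hbr hw with
      ⟨F, hF, hτF, v, hvW, hv, E, hE, hfree⟩ | ⟨t, ht, htA, hwt⟩
    swap
    · refine Or.inl ⟨t, c, h, ?_, hh, ht, hcL, hchain, hwt⟩
      intro e he
      rcases List.mem_append.1 he with he | he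
      · exact htA e he
      · exact hmem e he
    right
    have hFcard : (vec F).support.card = l := by rw [hcard F hF, if_pos hτF]
    set N := (vec F).support \ verts vec (c ++ h) with hN
    have hNF : N ⊆ (vec F).support := Finset.sdiff_subset
    have hNcard : N.card + 1 = l := by
      have := Finset.card_inter_add_card_sdiff (vec F).support (verts vec (c ++ h))
      rw [hv, Finset.card_singleton, hFcard, ← hN] at this
      omega
    have hEcard : ∀ u ∈ N, (vec (E u)).support.card = k := fun u hu => by
      rw [hcard _ (hE u (hNF hu)).1, (hE u (hNF hu)).2.1]; simp
    have hEF : ∀ u ∈ N, (vec F).support ∩ (vec (E u)).support = {u} :=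
      fun u hu => (hE u (hNF hu)).2.2
    have hassoc : (N.toList.map E ++ F :: c) ++ h = N.toList.map E ++ F :: (c ++ h) := by simp
    refine ⟨N.toList.map E ++ F :: c, h, ?_, hh, ?_, Or.inr ?_, ?_, ?_, ?_⟩
    · rw [hassoc]
      intro e he
      rcases List.mem_append.1 he with he | he
      · obtain ⟨u, hu, rfl⟩ := List.mem_map.1 he
        exact (hE u (hNF (by simpa using hu))).1
      · rcases List.mem_cons.1 he with rfl | he
        · exact hF
        · exact hmem e he
    · rw [List.length_append, List.length_map, Finset.length_toList, List.length_cons]; omega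
    · rw [List.length_append, List.length_map, Finset.length_toList, List.length_cons]; omega
    · refine IsLocalChain.append (c := F :: c) ⟨⟨v, hv, hvW⟩, hchain⟩ ?_
      exact hfree.isLocalChain hNF hEF (fun u hu => by simpa using hu)
        (Finset.nodup_toList _) (by rw [Finset.length_toList]; omega)
    · rw [hassoc]
      exact (free_cluster_weight hk hN hFcard hEcard hEF (Finset.card_pos.1 (by omega))
        (by rw [hv]; simp) hfree).trans hw
    · rw [hassoc]
      exact hfree.hasBranches hk (by omega) (by omega) hEcard
        (fun u hu => (hE u (hNF hu)).2.1) hNF hEF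

theorem dense_or_long [DecidableEq ι] {k l L : ℕ} (hk : 3 ≤ k) (hkl : k ≤ l)
    {τ : ι → Bool} {𝓐 : Finset ι} (hcard : ∀ e ∈ 𝓐, (vec e).support.card = if τ e then l else k)
    (hA : Unavoidable vec τ 𝓐) :
    HasDenseConfig vec k l l (2 * l + 2) (L + l) 𝓐 ∨ HasLongChain vec k l l L 𝓐 := by
  obtain ⟨𝓑, hB𝓐, hB, hmin⟩ := exists_minimal_unavoidable hA
  have hmono : HasDenseConfig vec k l l (2 * l + 2) (L + l) 𝓑 ∨ HasLongChain vec k l l L 𝓑 := by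
    rcases hkl.lt_or_eq with hlt | rfl
    · exact dense_or_long_of_lt hk hlt le_rfl (fun e he => hcard e (hB𝓐 he)) hB hmin
    · rcases dense_or_long_of_equal_lengths (L := L) (W := k) hk hk
        (fun e he => by simpa using hcard e (hB𝓐 he)) hB hmin with
        ⟨t, c, h, h1, h2, h3, h4, h5, h6⟩ | h
      · exact Or.inl ⟨t, c, h, h1, h2, by omega, by omega, h5, h6⟩
      · exact Or.inr h
  rcases hmono with ⟨t, c, h, h1, h2⟩ | ⟨c, h, h1, h2⟩
  · exact Or.inl ⟨t, c, h, fun e he => hB𝓐 (h1 e he), h2⟩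
  · exact Or.inr ⟨c, h, fun e he => hB𝓐 (h1 e he), h2⟩

end UnequalLengths

/-! ### Solutions as edges with coefficient vectors -/

section Edges

variable {K : Bool → ℕ} {α β : Type*}

/-- A tuple of length `K false` or `K true`. -/
abbrev Edge (K : Bool → ℕ) (α : Type*) := Σ τ : Bool, (Fin (K τ) → α)

/-- The image of an edge under a map of the vertices. -/
def Edge.map (f : α → β) (e : Edge K α) : Edge K β := ⟨e.1, f ∘ e.2⟩

variable (a : (τ : Bool) → Fin (K τ) → ℤ)

/-- The coefficient vector of an edge. -/
noncomputable def edgeVec (e : Edge K α) : α →₀ ℚ :=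
  ∑ j, Finsupp.single (e.2 j) (a e.1 j : ℚ)

theorem edgeVec_map (f : α → β) (e : Edge K α) :
    edgeVec a (e.map f) = Finsupp.mapDomain f (edgeVec a e) := by
  simp only [edgeVec, Finsupp.mapDomain_finsetSum, Finsupp.mapDomain_single]
  rfl

variable {a}

theorem edgeVec_apply {e : Edge K α} (he : Function.Injective e.2) (j : Fin (K e.1)) :
    edgeVec a e (e.2 j) = a e.1 j := by
  classical
  rw [edgeVec, Finsupp.finsetSum_apply, Finset.sum_eq_single j]
  · simp
  · intro i _ hij
    rw [Finsupp.single_apply, if_neg (fun h => hij (he h))]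
  · simp

theorem support_edgeVec [DecidableEq α] (ha : ∀ τ j, a τ j ≠ 0) {e : Edge K α}
    (he : Function.Injective e.2) : (edgeVec a e).support = Finset.univ.image e.2 := by
  ext x
  rw [Finset.mem_image]
  constructor
  · intro hx
    by_contra hcon
    apply Finsupp.mem_support_iff.1 hx
    rw [edgeVec, Finsupp.finsetSum_apply]
    refine Finset.sum_eq_zero fun j _ => ?_
    rw [Finsupp.single_apply, if_neg (fun h => hcon ⟨j, by simp, h⟩)]
  · rintro ⟨j, -, rfl⟩
    rw [Finsupp.mem_support_iff, edgeVec_apply he]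
    exact_mod_cast ha _ _

theorem card_support_edgeVec (ha : ∀ τ j, a τ j ≠ 0) {e : Edge K α}
    (he : Function.Injective e.2) : (edgeVec a e).support.card = K e.1 := by
  classical
  rw [support_edgeVec ha he, Finset.card_image_of_injective _ he, Finset.card_univ,
    Fintype.card_fin]

end Edges

/-! ### Counting codes of configurations -/

section Codes

open Classical in
/-- All edges with labels below `m`. -/
noncomputable def wildEdges (K : Bool → ℕ) (m : ℕ) : Finset (Edge K ℕ) :=
  Finset.univ.sigma fun _ => Fintype.piFinset fun _ => Finset.range m

open Classical in
/-- The labels occurring in the first `W` edges of a list. -/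
noncomputable def windowLabels {K : Bool → ℕ} (W : ℕ) (c : List (Edge K ℕ)) : Finset ℕ :=
  (c.take W).toFinset.biUnion fun e => Finset.univ.image e.2

open Classical in
/-- The edges with exactly one label from the first `W` edges of `c`, and otherwise fresh
labels. -/
noncomputable def localEdges {K : Bool → ℕ} (l W : ℕ) (c : List (Edge K ℕ)) :
    Finset (Edge K ℕ) :=
  ((Finset.univ : Finset (Σ τ : Bool, Fin (K τ))) ×ˢ windowLabels W c).image fun x =>
    ⟨x.1.1, fun q => if q = x.1.2 then x.2 else l * c.length + q⟩

open Classical in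
/-- Prolong each code by a local edge. -/
noncomputable def localStep {K : Bool → ℕ} (l W : ℕ) (C : Finset (List (Edge K ℕ))) :
    Finset (List (Edge K ℕ)) :=
  C.biUnion fun c => (localEdges l W c).image (· :: c)

open Classical in
/-- Prolong each code by at most one arbitrary edge. -/
noncomputable def wildStep {K : Bool → ℕ} (l : ℕ) (C : Finset (List (Edge K ℕ))) :
    Finset (List (Edge K ℕ)) :=
  C ∪ C.biUnion fun c => (wildEdges K (l * (c.length + 1))).image (· :: c)

/-- The codes of local chains of length `j` starting from at most three edges. -/
noncomputable def chainCodes (K : Bool → ℕ) (l W j : ℕ) : Finset (List (Edge K ℕ)) :=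
  (localStep l W)^[j] ((wildStep l)^[3] {[]})

/-- The codes of local chains of length `j`, prolonged by at most `D` arbitrary edges. -/
noncomputable def configCodes (K : Bool → ℕ) (l W D j : ℕ) : Finset (List (Edge K ℕ)) :=
  (wildStep l)^[D] (chainCodes K l W j)

variable {K : Bool → ℕ} {l W : ℕ} {C : Finset (List (Edge K ℕ))}

theorem card_wildEdges_le (hK : ∀ τ, K τ ≤ l) {m : ℕ} (hm : 1 ≤ m) :
    (wildEdges K m).card ≤ 2 * m ^ l := by
  simp only [wildEdges, Finset.card_sigma, Fintype.card_piFinset, Finset.card_range,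
    Finset.prod_const, Finset.card_univ, Fintype.card_fin]
  calc ∑ τ : Bool, m ^ K τ ≤ ∑ _τ : Bool, m ^ l :=
        Finset.sum_le_sum fun τ _ => Nat.pow_le_pow_right hm (hK τ)
    _ = 2 * m ^ l := by simp

theorem card_windowLabels_le (hK : ∀ τ, K τ ≤ l) (c : List (Edge K ℕ)) :
    (windowLabels W c).card ≤ W * l := by
  refine (Finset.card_biUnion_le_card_mul _ _ l fun e _ => ?_).trans ?_
  · exact Finset.card_image_le.trans (by simpa using hK e.1)
  · refine Nat.mul_le_mul_right _ ((List.toFinset_card_le _).trans ?_)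
    simp

/-- Only the type, the position of the old vertex and its label are free; fresh labels are
prescribed. The bound does not depend on the length of `c`, which keeps the number of chain codes
exponential. -/
theorem card_localEdges_le (hK : ∀ τ, K τ ≤ l) (c : List (Edge K ℕ)) :
    (localEdges l W c).card ≤ 2 * l * (W * l) := by
  refine Finset.card_image_le.trans ?_
  rw [Finset.card_product]
  refine Nat.mul_le_mul ?_ (card_windowLabels_le hK c)
  rw [Finset.card_univ, Fintype.card_sigma]
  simp only [Fintype.card_fin, Fintype.univ_bool, Finset.sum_insert, Finset.mem_singleton,
    Bool.true_eq_false, not_false_eq_true, Finset.sum_singleton]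
  have := hK true
  have := hK false
  omega

theorem card_localStep_le (hK : ∀ τ, K τ ≤ l) :
    (localStep l W C).card ≤ C.card * (2 * l * (W * l)) :=
  Finset.card_biUnion_le_card_mul _ _ _ fun c _ =>
    Finset.card_image_le.trans (card_localEdges_le hK c)

theorem card_wildStep_le (hK : ∀ τ, K τ ≤ l) (hl : 1 ≤ l) {m : ℕ} (hm : ∀ c ∈ C, c.length ≤ m) :
    (wildStep l C).card ≤ C.card * (1 + 2 * (l * (m + 1)) ^ l) := by
  rw [mul_add, mul_one]
  refine (Finset.card_union_le _ _).trans (Nat.add_le_add_left ?_ _)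
  refine Finset.card_biUnion_le_card_mul _ _ _ fun c hc => Finset.card_image_le.trans ?_
  refine (card_wildEdges_le hK (Nat.mul_pos hl (Nat.succ_pos _))).trans ?_
  have := hm c hc
  gcongr
  omega

theorem length_le_of_mem_localStep {m : ℕ} (hm : ∀ c ∈ C, c.length ≤ m) :
    ∀ c ∈ localStep l W C, c.length ≤ m + 1 := by
  intro c hc
  simp only [localStep, Finset.mem_biUnion, Finset.mem_image] at hc
  obtain ⟨c', hc', e, -, rfl⟩ := hc
  simpa using hm c' hc'

theorem length_le_of_mem_wildStep {m : ℕ} (hm : ∀ c ∈ C, c.length ≤ m) :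
    ∀ c ∈ wildStep l C, c.length ≤ m + 1 := by
  intro c hc
  simp only [wildStep, Finset.mem_union, Finset.mem_biUnion, Finset.mem_image] at hc
  rcases hc with hc | ⟨c', hc', e, -, rfl⟩
  · exact (hm c hc).trans (Nat.le_succ _)
  · simpa using hm c' hc'

/-- An unrestricted edge costs a factor polynomial in the length. This is affordable because `D`
stays bounded while the length is logarithmic in n. -/
theorem card_iterate_wildStep_le (hK : ∀ τ, K τ ≤ l) (hl : 1 ≤ l) {m : ℕ}
    (hm : ∀ c ∈ C, c.length ≤ m) (D : ℕ) :
    (∀ c ∈ (wildStep l)^[D] C, c.length ≤ m + D) ∧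
      ((wildStep l)^[D] C).card ≤ C.card * (1 + 2 * (l * (m + D + 1)) ^ l) ^ D := by
  induction D with
  | zero => simpa using hm
  | succ D ih =>
    rw [Function.iterate_succ_apply']
    refine ⟨length_le_of_mem_wildStep ih.1, (card_wildStep_le hK hl ih.1).trans ?_⟩
    calc _ ≤ (C.card * (1 + 2 * (l * (m + D + 1)) ^ l) ^ D) *
          (1 + 2 * (l * (m + D + 1)) ^ l) := Nat.mul_le_mul_right _ ih.2
      _ = C.card * (1 + 2 * (l * (m + D + 1)) ^ l) ^ (D + 1) := by ring
      _ ≤ _ := by gcongr; omega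

theorem card_chainCodes_le (hK : ∀ τ, K τ ≤ l) (hl : 1 ≤ l) :
    ∃ H : ℕ, ∀ j, (∀ c ∈ chainCodes K l W j, c.length ≤ 3 + j) ∧
      (chainCodes K l W j).card ≤ H * (2 * l * (W * l)) ^ j := by
  refine ⟨((wildStep l)^[3] {([] : List (Edge K ℕ))}).card, fun j => ?_⟩
  have h0 := (card_iterate_wildStep_le (C := {([] : List (Edge K ℕ))}) hK hl (m := 0)
    (by simp) 3).1
  induction j with
  | zero => simpa [chainCodes] using h0
  | succ j ih =>
    rw [chainCodes, Function.iterate_succ_apply', ← chainCodes]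
    refine ⟨length_le_of_mem_localStep ih.1, (card_localStep_le hK).trans ?_⟩
    exact (Nat.mul_le_mul_right _ ih.2).trans_eq (by ring)

theorem card_configCodes_le (hK : ∀ τ, K τ ≤ l) (hl : 1 ≤ l) :
    ∃ H : ℕ, ∀ D j, (configCodes K l W D j).card ≤
      H * (2 * l * (W * l)) ^ j * (1 + 2 * (l * (3 + j + D + 1)) ^ l) ^ D := by
  obtain ⟨H, hH⟩ := card_chainCodes_le (W := W) hK hl
  refine ⟨H, fun D j => ?_⟩
  exact (card_iterate_wildStep_le hK hl (hH j).1 D).2.trans (Nat.mul_le_mul_right _ (hH j).2)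

end Codes

/-! ### From configurations to codes -/

section Labelling

variable {K : Bool → ℕ} {a : (τ : Bool) → Fin (K τ) → ℤ} {l W : ℕ}
  {C : Finset (List (Edge K ℕ))} {Γ : List (Edge K ℤ)}

/-- The vertices of `Γ` can be labelled in such a way that the code of `Γ` lies in `C`. -/
def IsCoded (a : (τ : Bool) → Fin (K τ) → ℤ) (l : ℕ) (C : Finset (List (Edge K ℕ)))
    (Γ : List (Edge K ℤ)) : Prop :=
  ∃ f : ℤ → ℕ, Set.InjOn f (verts (edgeVec a) Γ) ∧
    (∀ v ∈ verts (edgeVec a) Γ, f v < l * Γ.length) ∧ Γ.map (Edge.map f) ∈ C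

theorem apply_mem_verts (ha : ∀ τ j, a τ j ≠ 0) {e : Edge K ℤ} (he : Function.Injective e.2)
    (hΓ : e ∈ Γ) (j : Fin (K e.1)) : e.2 j ∈ verts (edgeVec a) Γ :=
  support_subset_verts hΓ (by rw [support_edgeVec ha he]; simp)

/-- Old labels lie below `l * Γ.length`, so adding the position to this number gives fresh labels.
As these depend on the position alone, an attached edge acquires exactly the code listed in
`localEdges`. -/
theorem extend_labelling (ha : ∀ τ j, a τ j ≠ 0) (hK : ∀ τ, K τ ≤ l)
    (hΓ : ∀ e ∈ Γ, Function.Injective e.2) {f : ℤ → ℕ}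
    (hf : Set.InjOn f (verts (edgeVec a) Γ)) (hlt : ∀ v ∈ verts (edgeVec a) Γ, f v < l * Γ.length)
    {e : Edge K ℤ} (he : Function.Injective e.2) :
    ∃ g : ℤ → ℕ, Set.InjOn g (verts (edgeVec a) (e :: Γ)) ∧
      (∀ v ∈ verts (edgeVec a) (e :: Γ), g v < l * (Γ.length + 1)) ∧
      (∀ v ∈ verts (edgeVec a) Γ, g v = f v) ∧ Γ.map (Edge.map g) = Γ.map (Edge.map f) ∧
      ∀ j, e.2 j ∉ verts (edgeVec a) Γ → g (e.2 j) = l * Γ.length + j := by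
  classical
  set X := verts (edgeVec a) Γ with hX
  set g : ℤ → ℕ := fun x => if x ∈ X then f x else
    if h : ∃ j, e.2 j = x then l * Γ.length + (h.choose : ℕ) else 0 with hg
  have hgX : ∀ v ∈ X, g v = f v := fun v hv => by rw [hg]; simp [hv]
  have hgE : ∀ j, e.2 j ∉ X → g (e.2 j) = l * Γ.length + j := fun j hj => by
    have hex : ∃ i, e.2 i = e.2 j := ⟨j, rfl⟩
    rw [hg]
    simp only [if_neg hj, dif_pos hex]
    rw [he hex.choose_spec]
  have hcase : ∀ v ∈ verts (edgeVec a) (e :: Γ), v ∈ X ∨ ∃ j, e.2 j = v ∧ e.2 j ∉ X := by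
    intro v hv
    simp only [verts, support_edgeVec ha he, Finset.mem_union, Finset.mem_image] at hv
    by_cases hvX : v ∈ X
    · exact Or.inl hvX
    · rcases hv with ⟨j, -, rfl⟩ | hv
      · exact Or.inr ⟨j, rfl, hvX⟩
      · exact absurd hv hvX
  refine ⟨g, ?_, ?_, hgX, ?_, hgE⟩
  · intro v hv v' hv' hvv
    rcases hcase v hv with h1 | ⟨j, rfl, h1⟩ <;> rcases hcase v' hv' with h2 | ⟨i, rfl, h2⟩
    · rw [hgX v h1, hgX v' h2] at hvv
      exact hf h1 h2 hvv
    · rw [hgX v h1, hgE i h2] at hvv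
      have := hlt v h1
      omega
    · rw [hgX v' h2, hgE j h1] at hvv
      have := hlt v' h2
      omega
    · rw [hgE j h1, hgE i h2] at hvv
      have : j = i := Fin.ext (by omega)
      rw [this]
  · intro v hv
    rw [mul_add, mul_one]
    rcases hcase v hv with h1 | ⟨j, rfl, h1⟩
    · rw [hgX v h1]
      have := hlt v h1
      omega
    · rw [hgE j h1]
      have := j.2
      have := hK e.1
      omega
  · refine List.map_congr_left fun e' he' => ?_
    have : g ∘ e'.2 = f ∘ e'.2 := funext fun j => hgX _ (apply_mem_verts ha (hΓ e' he') he' j)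
    simp [Edge.map, this]

theorem IsCoded.wild (ha : ∀ τ j, a τ j ≠ 0) (hK : ∀ τ, K τ ≤ l)
    (hΓ : ∀ e ∈ Γ, Function.Injective e.2) (h : IsCoded a l C Γ)
    {e : Edge K ℤ} (he : Function.Injective e.2) : IsCoded a l (wildStep l C) (e :: Γ) := by
  obtain ⟨f, hf, hlt, hC⟩ := h
  obtain ⟨g, hg, hglt, -, hmap, -⟩ := extend_labelling ha hK hΓ hf hlt he
  refine ⟨g, hg, hglt, ?_⟩
  rw [List.map_cons, hmap]
  simp only [wildStep, Finset.mem_union, Finset.mem_biUnion, Finset.mem_image]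
  refine Or.inr ⟨_, hC, _, ?_, rfl⟩
  simp only [wildEdges, Finset.mem_sigma, Finset.mem_univ, true_and, Fintype.mem_piFinset,
    Finset.mem_range, List.length_map]
  intro j
  refine hglt _ (apply_mem_verts ha he (by simp) j)

theorem IsCoded.mono {C' : Finset (List (Edge K ℕ))} (h : IsCoded a l C Γ) (hC : C ⊆ C') :
    IsCoded a l C' Γ := by
  obtain ⟨f, hf, hlt, hm⟩ := h
  exact ⟨f, hf, hlt, hC hm⟩

theorem subset_iterate_wildStep (D : ℕ) : C ⊆ (wildStep l)^[D] C := by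
  induction D with
  | zero => simp
  | succ D ih =>
    rw [Function.iterate_succ_apply']
    exact ih.trans Finset.subset_union_left

theorem IsCoded.iterate_wild (ha : ∀ τ j, a τ j ≠ 0) (hK : ∀ τ, K τ ≤ l)
    (h : IsCoded a l C Γ) {t : List (Edge K ℤ)} (ht : ∀ e ∈ t ++ Γ, Function.Injective e.2)
    {D : ℕ} (hD : t.length ≤ D) : IsCoded a l ((wildStep l)^[D] C) (t ++ Γ) := by
  induction t generalizing D with
  | nil => exact h.mono (subset_iterate_wildStep D)
  | cons e t ih =>
    obtain ⟨D, rfl⟩ : ∃ D', D = D' + 1 := ⟨D - 1, by simp at hD; omega⟩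
    rw [Function.iterate_succ_apply']
    have ht' : ∀ e ∈ t ++ Γ, Function.Injective e.2 := fun e' he' =>
      ht e' (by rw [List.cons_append]; exact List.mem_cons_of_mem _ he')
    exact IsCoded.wild ha hK ht' (ih ht' (by simpa using hD)) (ht e (by simp))

theorem IsCoded.attach (ha : ∀ τ j, a τ j ≠ 0) (hK : ∀ τ, K τ ≤ l)
    (hΓ : ∀ e ∈ Γ, Function.Injective e.2) (h : IsCoded a l C Γ)
    {e : Edge K ℤ} (he : Function.Injective e.2) (hatt : Attaches (edgeVec a) W e Γ) :
    IsCoded a l (localStep l W C) (e :: Γ) := by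
  obtain ⟨f, hf, hlt, hC⟩ := h
  obtain ⟨g, hg, hglt, hgX, hmap, hgE⟩ := extend_labelling ha hK hΓ hf hlt he
  refine ⟨g, hg, hglt, ?_⟩
  rw [List.map_cons, hmap]
  simp only [localStep, Finset.mem_biUnion, Finset.mem_image]
  refine ⟨_, hC, _, ?_, rfl⟩
  obtain ⟨v, hv, hvW⟩ := hatt
  have hv' : v ∈ (edgeVec a e).support ∩ verts (edgeVec a) Γ := by simp [hv]
  rw [Finset.mem_inter, support_edgeVec ha he, Finset.mem_image] at hv'
  obtain ⟨⟨p, -, rfl⟩, hpΓ⟩ := hv'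
  simp only [localEdges, Finset.mem_image, Finset.mem_product, Finset.mem_univ, true_and]
  refine ⟨(⟨e.1, p⟩, g (e.2 p)), ?_, ?_⟩
  · obtain ⟨e', he', hpe'⟩ := mem_verts.1 hvW
    have he'Γ := List.mem_of_mem_take he'
    rw [support_edgeVec ha (hΓ e' he'Γ), Finset.mem_image] at hpe'
    obtain ⟨i, -, hi⟩ := hpe'
    simp only [windowLabels, Finset.mem_biUnion, List.mem_toFinset, Finset.mem_image]
    refine ⟨e'.map g, ?_, i, Finset.mem_univ _, ?_⟩
    · rw [← hmap, ← List.map_take]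
      exact List.mem_map_of_mem he'
    · exact congrArg g hi
  · simp only [Edge.map, List.length_map]
    congr 1
    funext q
    by_cases hq : q = p
    · simp [hq]
    · rw [if_neg hq, Function.comp_apply, hgE]
      intro hqΓ
      have : e.2 q ∈ (edgeVec a e).support ∩ verts (edgeVec a) Γ :=
        Finset.mem_inter.2 ⟨by rw [support_edgeVec ha he]; simp, hqΓ⟩
      rw [hv, Finset.mem_singleton] at this
      exact hq (he this)

theorem isCoded_chain (ha : ∀ τ j, a τ j ≠ 0) (hK : ∀ τ, K τ ≤ l) {c h : List (Edge K ℤ)}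
    (hinj : ∀ e ∈ c ++ h, Function.Injective e.2) (hh : h.length ≤ 3)
    (hc : IsLocalChain (edgeVec a) W c h) : IsCoded a l (chainCodes K l W c.length) (c ++ h) := by
  induction c with
  | nil =>
    have h0 : IsCoded a l {[]} ([] : List (Edge K ℤ)) := ⟨fun _ => 0, by simp [verts],
      by simp [verts], by simp⟩
    have := h0.iterate_wild (t := h) ha hK (by simpa using hinj) hh
    simpa [chainCodes] using this
  | cons e c ih =>
    have hinj' : ∀ e ∈ c ++ h, Function.Injective e.2 := fun e' he' =>
      hinj e' (by rw [List.cons_append]; exact List.mem_cons_of_mem _ he')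
    rw [List.length_cons, chainCodes, Function.iterate_succ_apply', ← chainCodes]
    exact (ih hinj' hc.2).attach ha hK hinj' (hinj e (by simp)) hc.1

/-- The set `S` contains an injective copy of the code `κ`. -/
def IsRealized (a : (τ : Bool) → Fin (K τ) → ℤ) (κ : List (Edge K ℕ)) (S : Set ℤ) : Prop :=
  ∃ x : ℕ → ℤ, Set.InjOn x (verts (edgeVec a) κ) ∧ (∀ v ∈ verts (edgeVec a) κ, x v ∈ S) ∧
    ∀ e ∈ κ, Function.Injective e.2 ∧ ∑ j, a e.1 j * x (e.2 j) = 0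

/-- Inverting the labelling induces a linear map that carries the relation space of the code onto a
space containing that of `Γ`, so passing to the code cannot lower the rank. Hence it cannot raise
the weight. -/
theorem IsCoded.exists_realized (ha : ∀ τ j, a τ j ≠ 0) (h : IsCoded a l C Γ) {S : Set ℤ}
    (hinj : ∀ e ∈ Γ, Function.Injective e.2) (hS : ∀ e ∈ Γ, ∀ j, e.2 j ∈ S)
    (hsol : ∀ e ∈ Γ, ∑ j, a e.1 j * e.2 j = 0) :
    ∃ κ ∈ C, IsRealized a κ S ∧ (verts (edgeVec a) κ).card = (verts (edgeVec a) Γ).card ∧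
      relRank (edgeVec a) Γ ≤ relRank (edgeVec a) κ := by
  classical
  obtain ⟨f, hf, -, hC⟩ := h
  set x := Function.invFunOn f (verts (edgeVec a) Γ : Set ℤ) with hx
  have hxf : ∀ v ∈ verts (edgeVec a) Γ, x (f v) = v := fun v hv => hf.leftInvOn_invFunOn hv
  have hinjmap : ∀ e ∈ Γ, Function.Injective (e.map f).2 := fun e he i j hij =>
    hinj e he (hf (apply_mem_verts ha (hinj e he) he i) (apply_mem_verts ha (hinj e he) he j) hij)
  have hverts : verts (edgeVec a) (Γ.map (Edge.map f)) = (verts (edgeVec a) Γ).image f := by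
    ext v
    rw [mem_verts, Finset.mem_image]
    constructor
    · rintro ⟨e', he', hv⟩
      obtain ⟨e, he, rfl⟩ := List.mem_map.1 he'
      rw [support_edgeVec ha (hinjmap e he), Finset.mem_image] at hv
      obtain ⟨j, -, rfl⟩ := hv
      exact ⟨e.2 j, apply_mem_verts ha (hinj e he) he j, rfl⟩
    · rintro ⟨u, hu, rfl⟩
      obtain ⟨e, he, hue⟩ := mem_verts.1 hu
      rw [support_edgeVec ha (hinj e he), Finset.mem_image] at hue
      obtain ⟨j, -, rfl⟩ := hue
      refine ⟨e.map f, List.mem_map_of_mem he, ?_⟩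
      rw [support_edgeVec ha (hinjmap e he)]
      exact Finset.mem_image.2 ⟨j, Finset.mem_univ _, rfl⟩
  refine ⟨_, hC, ⟨x, ?_, ?_, ?_⟩, ?_, ?_⟩
  · rw [hverts]
    intro v hv v' hv' hvv
    rw [Finset.coe_image] at hv hv'
    obtain ⟨u, hu, rfl⟩ := hv
    obtain ⟨u', hu', rfl⟩ := hv'
    rw [hxf u hu, hxf u' hu'] at hvv
    rw [hvv]
  · rw [hverts]
    intro v hv
    obtain ⟨u, hu, rfl⟩ := Finset.mem_image.1 hv
    rw [hxf u hu]
    obtain ⟨e, he, hue⟩ := mem_verts.1 hu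
    rw [support_edgeVec ha (hinj e he), Finset.mem_image] at hue
    obtain ⟨j, -, rfl⟩ := hue
    exact hS e he j
  · intro e' he'
    obtain ⟨e, he, rfl⟩ := List.mem_map.1 he'
    refine ⟨hinjmap e he, ?_⟩
    rw [← hsol e he]
    refine Finset.sum_congr rfl fun j _ => ?_
    exact congrArg (a e.1 j * ·) (hxf _ (apply_mem_verts ha (hinj e he) he j))
  · rw [hverts, Finset.card_image_of_injOn hf]
  · have hsp : relSpace (edgeVec a) Γ ≤
        (relSpace (edgeVec a) (Γ.map (Edge.map f))).map (Finsupp.lmapDomain ℚ ℚ x) := by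
      apply Submodule.span_le.2
      rintro y ⟨e, he, rfl⟩
      refine ⟨edgeVec a (e.map f), vec_mem_relSpace (List.mem_map_of_mem he), ?_⟩
      rw [Finsupp.lmapDomain_apply, ← edgeVec_map]
      congr 1
      have : x ∘ (f ∘ e.2) = e.2 := funext fun j => hxf _ (apply_mem_verts ha (hinj e he) he j)
      simp [Edge.map, this]
    exact (Submodule.finrank_mono hsp).trans (Submodule.finrank_map_le _ _)

end Labelling

/-! ### Counting copies of a code -/

section Counting

/-- Steinitz exchange: adjoin unit vectors to `M` until the whole coordinate space is spanned. The
coordinates in `I` then serve as free parameters for solutions of the relations in `M`. -/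
theorem exists_spanning_coordinates {V : Type*} [DecidableEq V] (σ : Finset V)
    (M : Submodule ℚ (V →₀ ℚ)) (hM : M ≤ Finsupp.supported ℚ ℚ (σ : Set V)) :
    ∃ I ⊆ σ, I.card + Module.finrank ℚ M ≤ σ.card ∧
      Finsupp.supported ℚ ℚ (σ : Set V) ≤ M ⊔ Finsupp.supported ℚ ℚ (I : Set V) := by
  have hfin : FiniteDimensional ℚ (Finsupp.supported ℚ ℚ (σ : Set V)) :=
    Module.Finite.equiv (Finsupp.supportedEquivFinsupp (M := ℚ) (R := ℚ) (σ : Set V)).symm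
  have hfr : Module.finrank ℚ (Finsupp.supported ℚ ℚ (σ : Set V)) = σ.card := by
    rw [(Finsupp.supportedEquivFinsupp (M := ℚ) (R := ℚ) (σ : Set V)).finrank_eq]
    simp
  induction hd : σ.card - Module.finrank ℚ M generalizing M with
  | zero =>
    have hMfin : FiniteDimensional ℚ M := Submodule.finiteDimensional_of_le hM
    have hle := Submodule.finrank_mono hM
    have heq : M = Finsupp.supported ℚ ℚ (σ : Set V) :=
      Submodule.eq_of_le_of_finrank_le hM (by omega)
    refine ⟨∅, by simp, ?_, ?_⟩
    · rw [Finset.card_empty]; omega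
    · rw [← heq]; exact le_sup_left
  | succ d ih =>
    have hMfin : FiniteDimensional ℚ M := Submodule.finiteDimensional_of_le hM
    have hlt : ¬ Finsupp.supported ℚ ℚ (σ : Set V) ≤ M := fun h => by
      have := Submodule.finrank_mono (t := M) h
      omega
    obtain ⟨v, hv, hvM⟩ : ∃ v ∈ σ, Finsupp.single v (1 : ℚ) ∉ M := by
      by_contra hall
      push Not at hall
      apply hlt
      rw [Finsupp.supported_eq_span_single]
      apply Submodule.span_le.2
      rintro _ ⟨v, hv, rfl⟩
      exact hall v hv
    have h0 : Finsupp.single v (1 : ℚ) ≠ 0 := by simp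
    have hvσ : Submodule.span ℚ {Finsupp.single v (1 : ℚ)} ≤
        Finsupp.supported ℚ ℚ (σ : Set V) := by
      rw [Submodule.span_singleton_le_iff_mem]
      exact Finsupp.single_mem_supported ℚ 1 hv
    have hrank : Module.finrank ℚ ↥(M ⊔ Submodule.span ℚ {Finsupp.single v (1 : ℚ)}) =
        Module.finrank ℚ M + 1 := by
      have h1 := Submodule.finrank_sup_add_finrank_inf_eq M
        (Submodule.span ℚ {Finsupp.single v (1 : ℚ)})
      rw [((Submodule.disjoint_span_singleton' h0).2 hvM).eq_bot, finrank_bot,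
        finrank_span_singleton h0] at h1
      omega
    obtain ⟨I, hI, hcard, hspan⟩ := ih (M ⊔ Submodule.span ℚ {Finsupp.single v (1 : ℚ)})
      (sup_le hM hvσ) (by omega)
    refine ⟨insert v I, Finset.insert_subset hv hI, ?_, ?_⟩
    · have := Finset.card_insert_le v I
      omega
    · refine hspan.trans (sup_le (sup_le le_sup_left ?_) ?_)
      · refine le_sup_of_le_right ?_
        rw [Submodule.span_singleton_le_iff_mem]
        exact Finsupp.single_mem_supported ℚ 1 (by simp)
      · exact le_sup_of_le_right (Finsupp.supported_mono (by simp))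

variable {K : Bool → ℕ} (a : (τ : Bool) → Fin (K τ) → ℤ)

/-- The injective copies of the code `κ` in `{1, …, n}`. -/
noncomputable def copies (κ : List (Edge K ℕ)) (n : ℕ) :
    Finset (verts (edgeVec a) κ → ℤ) := by
  classical
  exact (Fintype.piFinset fun _ => Finset.Icc (1 : ℤ) n).filter fun x =>
    Function.Injective x ∧ ∀ e ∈ κ, ∑ j, a e.1 j *
      (if h : e.2 j ∈ verts (edgeVec a) κ then x ⟨e.2 j, h⟩ else 0) = 0

variable {a}

/-- The difference of two copies that agree on `I` is annihilated by the relations and by the unit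
vectors of `I`, hence by every unit vector. So a copy is determined by its values on `I`. -/
theorem card_copies_le (κ : List (Edge K ℕ)) (n : ℕ) :
    ∃ i : ℕ, i + relRank (edgeVec a) κ ≤ (verts (edgeVec a) κ).card ∧
      (copies a κ n).card ≤ n ^ i := by
  classical
  obtain ⟨I, hI, hcard, hspan⟩ := exists_spanning_coordinates (verts (edgeVec a) κ)
    (relSpace (edgeVec a) κ) (by
      intro y hy
      rw [Finsupp.mem_supported]
      intro v hv
      by_contra hcon
      exact (Finsupp.mem_support_iff.1 hv) (eq_zero_of_mem_relSpace hy hcon))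
  refine ⟨I.card, hcard, ?_⟩
  have hcardI : (Fintype.piFinset fun _ : I => Finset.Icc (1 : ℤ) n).card = n ^ I.card := by
    simp
  rw [← hcardI]
  refine Finset.card_le_card_of_injOn (fun x v => x ⟨v, hI v.2⟩) ?_ ?_
  · intro x hx
    have hx' := (Finset.mem_filter.1 hx).1
    rw [Fintype.mem_piFinset] at hx'
    exact Fintype.mem_piFinset.2 fun v => hx' _
  · intro x hx y hy hxy
    have hx' := (Finset.mem_filter.1 hx).2.2
    have hy' := (Finset.mem_filter.1 hy).2.2
    set z : ℕ → ℚ := fun v =>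
      if h : v ∈ verts (edgeVec a) κ then (x ⟨v, h⟩ : ℚ) - y ⟨v, h⟩ else 0 with hz
    have hrel : ∀ u ∈ relSpace (edgeVec a) κ, Finsupp.linearCombination ℚ z u = 0 := by
      intro u hu
      have hle : relSpace (edgeVec a) κ ≤ LinearMap.ker (Finsupp.linearCombination ℚ z) := by
        apply Submodule.span_le.2
        rintro _ ⟨e, he, rfl⟩
        rw [SetLike.mem_coe, LinearMap.mem_ker, edgeVec, map_sum]
        simp only [Finsupp.linearCombination_single, smul_eq_mul]
        have h1 := hx' e he
        have h2 := hy' e he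
        have h3 : (((∑ j, a e.1 j * (if h : e.2 j ∈ verts (edgeVec a) κ then x ⟨e.2 j, h⟩
          else 0)) - ∑ j, a e.1 j * (if h : e.2 j ∈ verts (edgeVec a) κ then y ⟨e.2 j, h⟩
          else 0) : ℤ) : ℚ) = 0 := by rw [h1, h2]; simp
        rw [← h3]
        push_cast
        rw [← Finset.sum_sub_distrib]
        refine Finset.sum_congr rfl fun j _ => ?_
        rw [hz]
        by_cases h : e.2 j ∈ verts (edgeVec a) κ
        · simp [h, mul_sub]
        · simp [h]
      exact hle hu
    have hzI : ∀ u ∈ Finsupp.supported ℚ ℚ (I : Set ℕ), Finsupp.linearCombination ℚ z u = 0 := by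
      intro u hu
      rw [Finsupp.linearCombination_apply]
      refine Finset.sum_eq_zero fun v hv => ?_
      have hvI : v ∈ I := (Finsupp.mem_supported ℚ u).1 hu hv
      have := congrFun hxy ⟨v, hvI⟩
      simp only at this
      rw [hz]
      simp [hI hvI, this]
    funext v
    have hv : Finsupp.single (v : ℕ) (1 : ℚ) ∈ relSpace (edgeVec a) κ ⊔
        Finsupp.supported ℚ ℚ (I : Set ℕ) := hspan (Finsupp.single_mem_supported ℚ 1 v.2)
    obtain ⟨u, hu, w, hw, huw⟩ := Submodule.mem_sup.1 hv
    have := congrArg (Finsupp.linearCombination ℚ z) huw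
    rw [map_add, hrel u hu, hzI w hw, Finsupp.linearCombination_single, hz] at this
    simp only [v.2, dif_pos, smul_eq_mul, one_mul, add_zero] at this
    have h4 : (x v : ℚ) = y v := by linarith
    exact_mod_cast h4

end Counting

/-! ### Probability that a code is realized -/

section Probability

open MeasureTheory ProbabilityTheory

theorem randomSubset_superset (n : ℕ) (p : unitInterval) (T : Finset ℤ)
    (hT : ∀ t ∈ T, t ∈ Set.Icc (1 : ℤ) n) :
    (randomSubset n p).real {S | ∀ t ∈ T, t ∈ S} = (p : ℝ) ^ T.card := by
  rw [randomSubset, measureReal_def, setBernoulli_apply']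
  have hset : ((fun q : ℤ → Prop => {i | q i}) ⁻¹' {S | ∀ t ∈ T, t ∈ S}) =
      Set.pi (T : Set ℤ) fun _ => {True} := by
    ext q
    simp [Set.mem_pi]
  rw [hset, Measure.infinitePi_pi _ (fun _ _ => MeasurableSet.of_discrete)]
  rw [Finset.prod_congr rfl (g := fun _ => ((unitInterval.toNNReal p : NNReal) : ENNReal))]
  · simp
  · intro t ht
    have := hT t ht
    rw [Set.mem_Icc] at this
    simp [this]

variable {K : Bool → ℕ} {a : (τ : Bool) → Fin (K τ) → ℤ}

theorem measure_realized_le (ha : ∀ τ j, a τ j ≠ 0) (κ : List (Edge K ℕ)) (n : ℕ)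
    (p : unitInterval) :
    (randomSubset n p).real {S | S ⊆ Set.Icc (1 : ℤ) n ∧ IsRealized a κ S} ≤
      (copies a κ n).card * (p : ℝ) ^ (verts (edgeVec a) κ).card := by
  classical
  have : IsProbabilityMeasure (randomSubset n p) := by unfold randomSubset; infer_instance
  have hsub : {S | S ⊆ Set.Icc (1 : ℤ) n ∧ IsRealized a κ S} ⊆
      ⋃ x ∈ copies a κ n, {S | ∀ t ∈ Finset.univ.image x, t ∈ S} := by
    rintro S ⟨hS, x, hinj, hxS, hsol⟩
    refine Set.mem_iUnion₂.2 ⟨fun v => x v, ?_, ?_⟩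
    · refine Finset.mem_filter.2 ⟨Fintype.mem_piFinset.2 fun v => ?_, ?_, ?_⟩
      · have := hS (hxS v v.2)
        simpa using this
      · intro v v' h
        exact Subtype.ext (hinj v.2 v'.2 h)
      · intro e he
        obtain ⟨hei, h⟩ := hsol e he
        rw [← h]
        refine Finset.sum_congr rfl fun j _ => ?_
        rw [dif_pos (support_subset_verts he (by rw [support_edgeVec ha hei]; simp))]
    · simp only [Set.mem_ofPred_eq, Finset.mem_image, Finset.mem_univ, true_and]
      rintro t ⟨v, rfl⟩
      exact hxS v v.2
  refine (measureReal_mono hsub (measure_ne_top _ _)).trans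
    ((measureReal_biUnion_finset_le _ _).trans ?_)
  rw [← nsmul_eq_mul]
  refine Finset.sum_le_card_nsmul _ _ _ fun x hx => ?_
  have hx' := Finset.mem_filter.1 hx
  rw [randomSubset_superset, Finset.card_image_of_injective _ hx'.2.1]
  · simp
  · intro t ht
    obtain ⟨v, -, rfl⟩ := Finset.mem_image.1 ht
    simpa using (Fintype.mem_piFinset.1 hx'.1) v

end Probability

/-! ### First-moment bounds -/

section FirstMoment

open MeasureTheory ProbabilityTheory

variable {K : Bool → ℕ} {a : (τ : Bool) → Fin (K τ) → ℤ}

/-- With v vertices, rank ρ and θ = 1 - l/(k(l-1)), the exponent of n is v - ρ - θv, which is the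
weight divided by k(l-1). -/
theorem measure_realized_le_rpow (ha : ∀ τ j, a τ j ≠ 0) {k l : ℕ} (hk : 1 ≤ k) (hl : 2 ≤ l)
    {c : ℝ} {n : ℕ} (hn : 1 ≤ n) {p : unitInterval}
    (hp : (p : ℝ) ≤ c * (n : ℝ) ^ (-(1 - (l : ℝ) / (k * (l - 1))))) (κ : List (Edge K ℕ)) :
    (randomSubset n p).real {S | S ⊆ Set.Icc (1 : ℤ) n ∧ IsRealized a κ S} ≤
      c ^ (verts (edgeVec a) κ).card *
        (n : ℝ) ^ ((weight (edgeVec a) k l κ : ℝ) / (k * (l - 1))) := by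
  obtain ⟨i, hi, hcard⟩ := card_copies_le (a := a) κ n
  have hn0 : (0 : ℝ) < n := by exact_mod_cast hn
  have hn1 : (1 : ℝ) ≤ n := by exact_mod_cast hn
  have hk0 : (k : ℝ) ≠ 0 := by exact_mod_cast (by omega : k ≠ 0)
  have hl0 : (l : ℝ) - 1 ≠ 0 := by
    have : (2 : ℝ) ≤ l := by exact_mod_cast hl
    linarith
  set s := (verts (edgeVec a) κ).card with hs
  set θ : ℝ := 1 - (l : ℝ) / (k * (l - 1)) with hθ
  have hcard' : ((copies a κ n).card : ℝ) ≤ (n : ℝ) ^ ((s : ℝ) - relRank (edgeVec a) κ) := by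
    calc ((copies a κ n).card : ℝ) ≤ (n : ℝ) ^ i := by exact_mod_cast hcard
      _ = (n : ℝ) ^ (i : ℝ) := (Real.rpow_natCast _ _).symm
      _ ≤ _ := by
        apply Real.rpow_le_rpow_of_exponent_le hn1
        have : (i : ℝ) + relRank (edgeVec a) κ ≤ s := by exact_mod_cast hi
        linarith
  have hps : (p : ℝ) ^ s ≤ c ^ s * (n : ℝ) ^ (-θ * s) := by
    calc (p : ℝ) ^ s ≤ (c * (n : ℝ) ^ (-θ)) ^ s := pow_le_pow_left₀ p.2.1 hp s
      _ = _ := by rw [mul_pow, Real.rpow_mul_natCast hn0.le]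
  refine (measure_realized_le ha κ n p).trans ?_
  calc ((copies a κ n).card : ℝ) * (p : ℝ) ^ s
      ≤ (n : ℝ) ^ ((s : ℝ) - relRank (edgeVec a) κ) * (c ^ s * (n : ℝ) ^ (-θ * s)) :=
        mul_le_mul hcard' hps (pow_nonneg p.2.1 _) (Real.rpow_nonneg hn0.le _)
    _ = c ^ s * (n : ℝ) ^ ((s : ℝ) - relRank (edgeVec a) κ + -θ * s) := by
        rw [Real.rpow_add hn0]; ring
    _ = _ := by
        congr 2
        rw [hθ, weight]
        push_cast
        rw [← hs]
        field_simp
        ring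

/-- If `S` is unavoidable, then it contains a copy of a dense code or of a long chain. -/
theorem exists_realized_code (ha : ∀ τ j, a τ j ≠ 0) {k l : ℕ} (hk : 3 ≤ k) (hkl : k ≤ l)
    (hK : ∀ τ, K τ = if τ then l else k) {S : Set ℤ} (hSfin : S.Finite)
    (hS : ∀ χ : ℤ → Bool, ∃ τ, ∃ x : Fin (K τ) → ℤ, Function.Injective x ∧ (∀ j, x j ∈ S) ∧
      ∑ j, a τ j * x j = 0 ∧ ∀ j, χ (x j) = τ) (L : ℕ) :
    (∃ j < L + l + 1, ∃ κ ∈ configCodes K l l (2 * l + 2) j, IsRealized a κ S ∧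
      weight (edgeVec a) k l κ < 0 ∧ j ≤ (verts (edgeVec a) κ).card) ∨
    (∃ j < L + l + 1, ∃ κ ∈ chainCodes K l l j, IsRealized a κ S ∧ L ≤ j ∧
      weight (edgeVec a) k l κ ≤ k ∧ j ≤ (verts (edgeVec a) κ).card) := by
  classical
  set 𝓐 : Finset (Edge K ℤ) := (Finset.univ.sigma fun _ =>
    Fintype.piFinset fun _ => hSfin.toFinset).filter fun e =>
      Function.Injective e.2 ∧ ∑ j, a e.1 j * e.2 j = 0 with h𝓐
  have hmem : ∀ e ∈ 𝓐, Function.Injective e.2 ∧ (∑ j, a e.1 j * e.2 j = 0) ∧ ∀ j, e.2 j ∈ S := by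
    intro e he
    obtain ⟨h1, h2, h3⟩ := Finset.mem_filter.1 he
    refine ⟨h2, h3, fun j => ?_⟩
    have := (Fintype.mem_piFinset.1 (Finset.mem_sigma.1 h1).2) j
    simpa using this
  have hcard : ∀ e ∈ 𝓐, (edgeVec a e).support.card = if e.1 then l else k := fun e he => by
    rw [card_support_edgeVec ha (hmem e he).1, hK]
  have hun : Unavoidable (edgeVec a) Sigma.fst 𝓐 := by
    intro χ
    obtain ⟨τ, x, hinj, hxS, hsol, hχ⟩ := hS χ
    refine ⟨⟨τ, x⟩, ?_, ?_⟩
    · refine Finset.mem_filter.2 ⟨Finset.mem_sigma.2 ⟨Finset.mem_univ _,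
        Fintype.mem_piFinset.2 fun j => ?_⟩, hinj, hsol⟩
      simpa using hxS j
    · intro v hv
      rw [support_edgeVec ha hinj, Finset.mem_image] at hv
      obtain ⟨j, -, rfl⟩ := hv
      exact hχ j
  have hKl : ∀ τ, K τ ≤ l := fun τ => by rw [hK]; split <;> omega
  have hw : ∀ {Γ : List (Edge K ℤ)} {κ : List (Edge K ℕ)},
      (verts (edgeVec a) κ).card = (verts (edgeVec a) Γ).card →
      relRank (edgeVec a) Γ ≤ relRank (edgeVec a) κ →
      weight (edgeVec a) k l κ ≤ weight (edgeVec a) k l Γ := by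
    intro Γ κ h1 h2
    rw [weight, weight, h1]
    have h3 : (relRank (edgeVec a) Γ : ℤ) ≤ relRank (edgeVec a) κ := by exact_mod_cast h2
    have h4 : (0 : ℤ) ≤ k * (l - 1) := mul_nonneg (by simp) (by
      have : (3 : ℤ) ≤ l := by exact_mod_cast hk.trans hkl
      linarith)
    have := mul_le_mul_of_nonneg_left h3 h4
    linarith
  have h2card : ∀ e ∈ 𝓐, 2 ≤ (edgeVec a e).support.card := fun e he => by
    rw [hcard e he]; split <;> omega
  rcases dense_or_long (L := L) hk hkl hcard hun with
    ⟨t, c, h, hA, hh, ht, hc, hchain, hneg⟩ | ⟨c, h, hA, hh, hLc, hc, hchain, hle⟩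
  · left
    have hA' : ∀ e ∈ c ++ h, e ∈ 𝓐 := fun e he => hA e (List.mem_append_right _ he)
    have hcoded := (isCoded_chain ha hKl (fun e he => (hmem e (hA' e he)).1) hh hchain).iterate_wild
      ha hKl (t := t) (fun e he => (hmem e (hA e he)).1) ht
    obtain ⟨κ, hκ, hreal, hv, hr⟩ := hcoded.exists_realized ha
      (fun e he => (hmem e (hA e he)).1) (fun e he => (hmem e (hA e he)).2.2)
      (fun e he => (hmem e (hA e he)).2.1)
    refine ⟨c.length, by omega, κ, hκ, hreal, (hw hv hr).trans_lt hneg, ?_⟩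
    rw [hv]
    refine (hchain.length_le_card fun e he => h2card e (hA' e (by simp [he]))).trans
      (Finset.card_le_card (verts_mono fun e he => List.mem_append_right _ he))
  · right
    have hcoded := isCoded_chain ha hKl (fun e he => (hmem e (hA e he)).1) hh hchain
    obtain ⟨κ, hκ, hreal, hv, hr⟩ := hcoded.exists_realized ha
      (fun e he => (hmem e (hA e he)).1) (fun e he => (hmem e (hA e he)).2.2)
      (fun e he => (hmem e (hA e he)).2.1)
    refine ⟨c.length, by omega, κ, hκ, hreal, hLc, (hw hv hr).trans hle, ?_⟩
    rw [hv]
    exact hchain.length_le_card fun e he => h2card e (hA e (by simp [he]))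

theorem measure_biUnion_codes_le {n : ℕ} {p : unitInterval} (C : Finset (List (Edge K ℕ)))
    (P : List (Edge K ℕ) → Prop) {b : ℝ} (hb : 0 ≤ b)
    (hP : ∀ κ ∈ C, P κ →
      (randomSubset n p).real {S | S ⊆ Set.Icc (1 : ℤ) n ∧ IsRealized a κ S} ≤ b) :
    (randomSubset n p).real (⋃ κ ∈ C, {S | P κ ∧ S ⊆ Set.Icc (1 : ℤ) n ∧ IsRealized a κ S}) ≤
      C.card * b := by
  refine (measureReal_biUnion_finset_le _ _).trans ?_
  rw [← nsmul_eq_mul]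
  refine Finset.sum_le_card_nsmul _ _ _ fun κ hκ => ?_
  by_cases h : P κ
  · simpa [h] using hP κ hκ h
  · simpa [h] using hb

/-- The first summand accounts for dense configurations and the second for long chains. The length
`L` is left free, to be balanced against n at the end. -/
theorem measure_unavoidable_le (ha : ∀ τ j, a τ j ≠ 0) {k l : ℕ} (hk : 3 ≤ k) (hkl : k ≤ l)
    (hK : ∀ τ, K τ = if τ then l else k) :
    ∃ H : ℕ, ∀ (n : ℕ) (p : unitInterval) (L : ℕ), 1 ≤ n →
      (p : ℝ) ≤ Real.exp (-1) / (2 * l * (l * l) : ℕ) *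
        (n : ℝ) ^ (-(1 - (l : ℝ) / (k * (l - 1)))) →
      (randomSubset n p).real {S | ∀ χ : ℤ → Bool, ∃ τ, ∃ x : Fin (K τ) → ℤ,
          Function.Injective x ∧ (∀ j, x j ∈ S) ∧ ∑ j, a τ j * x j = 0 ∧ ∀ j, χ (x j) = τ} ≤
        (L + l + 1) * (H * (1 + 2 * (l * (L + 3 * l + 6)) ^ l) ^ (2 * l + 2) *
            (n : ℝ) ^ (-(1 / (k * (l - 1)) : ℝ))) +
          (L + l + 1) * (H * Real.exp (-L) * (n : ℝ) ^ (1 / 2 : ℝ)) := by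
  have hKl : ∀ τ, K τ ≤ l := fun τ => by rw [hK]; split <;> omega
  have hl3 : 3 ≤ l := hk.trans hkl
  obtain ⟨H₁, hH₁⟩ := card_chainCodes_le (W := l) hKl (by omega)
  obtain ⟨H₂, hH₂⟩ := card_configCodes_le (W := l) hKl (by omega)
  refine ⟨H₁ + H₂, fun n p L hn hp => ?_⟩
  have : IsProbabilityMeasure (randomSubset n p) := by unfold randomSubset; infer_instance
  -- `B` bounds the number of local prolongations of a code for a window of l edges; dividing by it
  -- in `c` turns `B ^ j * c ^ j` into `exp (-j)`.
  set B : ℕ := 2 * l * (l * l) with hB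
  have hBpos : 1 ≤ B := Nat.mul_pos (by omega) (Nat.mul_pos (by omega) (by omega))
  have hB1 : (1 : ℝ) ≤ B := by exact_mod_cast hBpos
  set c : ℝ := Real.exp (-1) / B with hc
  have hc0 : 0 < c := div_pos (Real.exp_pos _) (by linarith)
  have he1 : Real.exp (-1) ≤ 1 := by rw [Real.exp_le_one_iff]; norm_num
  have hc1 : c ≤ 1 := by
    rw [hc, div_le_one (by linarith)]
    linarith
  have hBc : ∀ j : ℕ, (B : ℝ) ^ j * c ^ j = Real.exp (-j) := fun j => by
    rw [← mul_pow, hc, mul_div_cancel₀ _ (by linarith), ← Real.exp_nat_mul]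
    congr 1; ring
  have hn0 : (0 : ℝ) < n := by exact_mod_cast hn
  have hn1 : (1 : ℝ) ≤ n := by exact_mod_cast hn
  have hk3 : (3 : ℝ) ≤ k := by exact_mod_cast hk
  have hl3' : (3 : ℝ) ≤ l := by exact_mod_cast hl3
  have hkl0 : (0 : ℝ) < k * (l - 1) := mul_pos (by linarith) (by linarith)
  set δ : ℝ := 1 / (k * (l - 1)) with hδ
  have hreal := measure_realized_le_rpow (a := a) ha (k := k) (l := l) (by omega) (by omega) hn hp
  have hdense : ∀ j, (randomSubset n p).real (⋃ κ ∈ configCodes K l l (2 * l + 2) j,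
      {S | (weight (edgeVec a) k l κ < 0 ∧ j ≤ (verts (edgeVec a) κ).card) ∧
        S ⊆ Set.Icc (1 : ℤ) n ∧ IsRealized a κ S}) ≤
      (configCodes K l l (2 * l + 2) j).card * (c ^ j * (n : ℝ) ^ (-δ)) := fun j => by
    refine measure_biUnion_codes_le _ _ (by positivity) ?_
    rintro κ - ⟨hneg, hj⟩
    refine (hreal κ).trans (mul_le_mul (pow_le_pow_of_le_one hc0.le hc1 hj) ?_
      (Real.rpow_nonneg hn0.le _) (pow_nonneg hc0.le _))
    apply Real.rpow_le_rpow_of_exponent_le hn1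
    have h1 : (weight (edgeVec a) k l κ : ℝ) ≤ -1 := by
      exact_mod_cast (by omega : weight (edgeVec a) k l κ ≤ -1)
    rw [hδ, ← neg_div]
    gcongr
  have hlong : ∀ j, (randomSubset n p).real (⋃ κ ∈ chainCodes K l l j,
      {S | (L ≤ j ∧ weight (edgeVec a) k l κ ≤ k ∧ j ≤ (verts (edgeVec a) κ).card) ∧
        S ⊆ Set.Icc (1 : ℤ) n ∧ IsRealized a κ S}) ≤
      H₁ * Real.exp (-L) * (n : ℝ) ^ (1 / 2 : ℝ) := fun j => by
    by_cases hLj : L ≤ j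
    · have h1 := measure_biUnion_codes_le (a := a) (n := n) (p := p) (chainCodes K l l j)
        (fun κ => L ≤ j ∧ weight (edgeVec a) k l κ ≤ k ∧ j ≤ (verts (edgeVec a) κ).card)
        (b := c ^ j * (n : ℝ) ^ (1 / 2 : ℝ)) (by positivity) ?_
      · refine h1.trans ?_
        have h2 : ((chainCodes K l l j).card : ℝ) ≤ H₁ * (B : ℝ) ^ j := by
          exact_mod_cast (hH₁ j).2
        have h3 : Real.exp (-j) ≤ Real.exp (-L) := by
          apply Real.exp_le_exp.2
          have : (L : ℝ) ≤ j := by exact_mod_cast hLj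
          linarith
        calc ((chainCodes K l l j).card : ℝ) * (c ^ j * (n : ℝ) ^ (1 / 2 : ℝ))
            ≤ H₁ * (B : ℝ) ^ j * (c ^ j * (n : ℝ) ^ (1 / 2 : ℝ)) := by gcongr
          _ = H₁ * ((B : ℝ) ^ j * c ^ j) * (n : ℝ) ^ (1 / 2 : ℝ) := by ring
          _ ≤ _ := by rw [hBc]; gcongr
      · rintro κ - ⟨-, hle, hj⟩
        refine (hreal κ).trans (mul_le_mul (pow_le_pow_of_le_one hc0.le hc1 hj) ?_
          (Real.rpow_nonneg hn0.le _) (pow_nonneg hc0.le _))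
        apply Real.rpow_le_rpow_of_exponent_le hn1
        have h1 : (weight (edgeVec a) k l κ : ℝ) ≤ k := by exact_mod_cast hle
        -- Weight at most k gives the exponent 1/(l-1), which is at most 1/2 because l ≥ 3.
        rw [div_le_div_iff₀ hkl0 (by norm_num)]
        nlinarith
    · have hempty : (⋃ κ ∈ chainCodes K l l j,
          {S | (L ≤ j ∧ weight (edgeVec a) k l κ ≤ k ∧ j ≤ (verts (edgeVec a) κ).card) ∧
          S ⊆ Set.Icc (1 : ℤ) n ∧ IsRealized a κ S}) = ∅ := by simp [hLj]
      rw [hempty, measureReal_empty]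
      positivity
  have hdense' : ∀ j < L + l + 1, (configCodes K l l (2 * l + 2) j).card *
      (c ^ j * (n : ℝ) ^ (-δ)) ≤
      H₂ * (1 + 2 * (l * (L + 3 * l + 6)) ^ l) ^ (2 * l + 2) * (n : ℝ) ^ (-δ) := by
    intro j hj
    have h2 : ((configCodes K l l (2 * l + 2) j).card : ℝ) ≤
        H₂ * (B : ℝ) ^ j * (1 + 2 * (l * (L + 3 * l + 6)) ^ l) ^ (2 * l + 2) := by
      have h3 : (configCodes K l l (2 * l + 2) j).card ≤
          H₂ * B ^ j * (1 + 2 * (l * (L + 3 * l + 6)) ^ l) ^ (2 * l + 2) := by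
        have hle : 3 + j + (2 * l + 2) + 1 ≤ L + 3 * l + 6 := by omega
        exact (hH₂ (2 * l + 2) j).trans (Nat.mul_le_mul_left _ (Nat.pow_le_pow_left
          (Nat.add_le_add_left (Nat.mul_le_mul_left _ (Nat.pow_le_pow_left
            (Nat.mul_le_mul_left _ hle) _)) _) _))
      exact_mod_cast h3
    calc ((configCodes K l l (2 * l + 2) j).card : ℝ) * (c ^ j * (n : ℝ) ^ (-δ))
        ≤ H₂ * (B : ℝ) ^ j * (1 + 2 * (l * (L + 3 * l + 6)) ^ l) ^ (2 * l + 2) *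
          (c ^ j * (n : ℝ) ^ (-δ)) := by gcongr
      _ = H₂ * ((B : ℝ) ^ j * c ^ j) * (1 + 2 * (l * (L + 3 * l + 6)) ^ l) ^ (2 * l + 2) *
          (n : ℝ) ^ (-δ) := by ring
      _ ≤ H₂ * 1 * (1 + 2 * (l * (L + 3 * l + 6)) ^ l) ^ (2 * l + 2) * (n : ℝ) ^ (-δ) := by
          rw [hBc]
          gcongr
          rw [Real.exp_le_one_iff]
          simp
      _ = _ := by rw [mul_one]
  -- The law is carried by subsets of {1, …, n}. Intersecting with these makes `S` finite, as the
  -- exploration requires.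
  rw [randomSubset, measureReal_def, setBernoulli_apply_eq_apply_subsets, ← measureReal_def,
    ← randomSubset]
  refine (measureReal_mono (s₂ := (⋃ j ∈ Finset.range (L + l + 1),
      ⋃ κ ∈ configCodes K l l (2 * l + 2) j,
      {S | (weight (edgeVec a) k l κ < 0 ∧ j ≤ (verts (edgeVec a) κ).card) ∧
        S ⊆ Set.Icc (1 : ℤ) n ∧ IsRealized a κ S}) ∪ (⋃ j ∈ Finset.range (L + l + 1),
      ⋃ κ ∈ chainCodes K l l j,
      {S | (L ≤ j ∧ weight (edgeVec a) k l κ ≤ k ∧ j ≤ (verts (edgeVec a) κ).card) ∧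
        S ⊆ Set.Icc (1 : ℤ) n ∧ IsRealized a κ S})) ?_ (measure_ne_top _ _)).trans ?_
  · rintro S ⟨hS, hSn⟩
    rcases exists_realized_code ha hk hkl hK ((Set.finite_Icc _ _).subset hSn) hS L with
      ⟨j, hj, κ, hκ, h1, h2, h3⟩ | ⟨j, hj, κ, hκ, h1, h2, h3, h4⟩
    · left
      simp only [Set.mem_iUnion, Finset.mem_range]
      exact ⟨j, hj, κ, hκ, ⟨h2, h3⟩, hSn, h1⟩
    · right
      simp only [Set.mem_iUnion, Finset.mem_range]
      exact ⟨j, hj, κ, hκ, ⟨h2, h3, h4⟩, hSn, h1⟩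
  · refine (measureReal_union_le _ _).trans (add_le_add ?_ ?_)
    · refine (measureReal_biUnion_finset_le _ _).trans ?_
      refine (Finset.sum_le_card_nsmul _ _ (H₂ * (1 + 2 * (l * (L + 3 * l + 6)) ^ l) ^ (2 * l + 2) *
        (n : ℝ) ^ (-δ)) fun j hj => (hdense j).trans (hdense' j (Finset.mem_range.1 hj))).trans ?_
      rw [Finset.card_range, nsmul_eq_mul]
      push_cast
      gcongr
      simp
    · refine (measureReal_biUnion_finset_le _ _).trans ?_
      refine (Finset.sum_le_card_nsmul _ _ _ fun j _ => hlong j).trans ?_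
      rw [Finset.card_range, nsmul_eq_mul]
      push_cast
      gcongr
      simp

end FirstMoment

/-! ### Evaluating m(A) and m(A, B) -/

section Thresholds

theorem rank_row_eq_one {n : Type*} [Fintype n] (M : Matrix (Fin 1) n ℚ) {j : n}
    (hj : M 0 j ≠ 0) : M.rank = 1 := by
  apply le_antisymm
  · simpa using M.rank_le_card_height
  · rw [Nat.one_le_iff_ne_zero]
    intro h0
    rw [Matrix.rank, Submodule.finrank_eq_zero, LinearMap.range_eq_bot] at h0
    classical
    have h1 := congrFun (LinearMap.congr_fun h0 (Pi.single j 1)) 0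
    exact hj (by simpa using h1)

namespace LinearEquation

variable (A B : LinearEquation)

theorem rankQ_underlyingMatrix (hA : 0 < A.length) : rankQ A.underlyingMatrix = 1 :=
  rank_row_eq_one _ (j := ⟨0, hA⟩) (by simpa [underlyingMatrix] using A.coeff_ne_zero ⟨0, hA⟩)

theorem rankCompl_univ : rankCompl A.underlyingMatrix Finset.univ = 0 := by
  have : IsEmpty {j : Fin A.length // j ∉ (Finset.univ : Finset (Fin A.length))} :=
    ⟨fun j => j.2 (Finset.mem_univ _)⟩
  rw [rankCompl]
  have h := Matrix.rank_le_card_width ((A.underlyingMatrix.map (Int.cast : ℤ → ℚ)).submatrix id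
    (Subtype.val : {j : Fin A.length // j ∉ (Finset.univ : Finset (Fin A.length))} → _))
  simpa using h

theorem rankCompl_of_ne_univ {W : Finset (Fin A.length)} (hW : W ≠ Finset.univ) :
    rankCompl A.underlyingMatrix W = 1 := by
  obtain ⟨j, hj⟩ : ∃ j, j ∉ W := by
    by_contra h
    push Not at h
    exact hW (Finset.eq_univ_iff_forall.2 h)
  exact rank_row_eq_one _ (j := ⟨j, hj⟩) (by simpa [underlyingMatrix] using A.coeff_ne_zero j)

theorem card_univ_le (hA : 3 ≤ A.length) :
    2 ≤ (Finset.univ : Finset (Fin A.length)).card := by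
  simp; omega

/-- Removing all columns lowers the rank from 1 to 0, and this choice of W attains the maximum;
every other W contributes the value 1. -/
theorem m_eq (hA : 3 ≤ A.length) : A.m = ((A.length : ℝ) - 1) / (A.length - 2) := by
  have hk : (3 : ℝ) ≤ A.length := by exact_mod_cast hA
  have : Nonempty {W : Finset (Fin A.length) // 2 ≤ W.card} := ⟨⟨_, A.card_univ_le hA⟩⟩
  rw [m, matrixM]
  apply le_antisymm
  · refine ciSup_le fun ⟨W, hW⟩ => ?_
    rw [A.rankQ_underlyingMatrix (by omega)]
    by_cases hu : W = Finset.univ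
    · subst hu
      rw [rankCompl_univ, Finset.card_univ, Fintype.card_fin]
      apply le_of_eq
      congr 1
      push_cast
      ring
    · rw [A.rankCompl_of_ne_univ hu]
      have hW' : (2 : ℝ) ≤ W.card := by exact_mod_cast hW
      push_cast
      rw [add_sub_cancel_right, div_self (by linarith), le_div_iff₀ (by linarith)]
      linarith
  · refine le_ciSup_of_le (Set.finite_range _).bddAbove ⟨_, A.card_univ_le hA⟩ ?_
    rw [A.rankQ_underlyingMatrix (by omega), rankCompl_univ, Finset.card_univ, Fintype.card_fin]
    apply le_of_eq
    congr 1
    push_cast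
    ring

theorem length_le_of_m_le {A B : LinearEquation} (hA : 3 ≤ A.length) (hB : 3 ≤ B.length)
    (h : B.m ≤ A.m) : A.length ≤ B.length := by
  rw [m_eq A hA, m_eq B hB] at h
  have hk : (3 : ℝ) ≤ A.length := by exact_mod_cast hA
  have hl : (3 : ℝ) ≤ B.length := by exact_mod_cast hB
  rw [div_le_div_iff₀ (by linarith) (by linarith)] at h
  have : (A.length : ℝ) ≤ B.length := by nlinarith
  exact_mod_cast this

/-- The full column set is again optimal. With γ = 1/(l-1), comparing it with a proper W amounts to
kγ ≤ |W|(1+γ), which follows from kγ ≤ lγ = 1+γ; this is where k ≤ l enters. -/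
theorem one_div_m₂_eq {A B : LinearEquation} (hA : 3 ≤ A.length) (hAB : A.length ≤ B.length) :
    1 / A.m₂ B = 1 - (B.length : ℝ) / (A.length * (B.length - 1)) := by
  have hk : (3 : ℝ) ≤ A.length := by exact_mod_cast hA
  have hkl : (A.length : ℝ) ≤ B.length := by exact_mod_cast hAB
  have : Nonempty {W : Finset (Fin A.length) // 2 ≤ W.card} := ⟨⟨_, A.card_univ_le hA⟩⟩
  set k : ℝ := (A.length : ℝ) with hkdef
  set l : ℝ := (B.length : ℝ) with hldef
  have hβ : 1 / matrixM B.underlyingMatrix = (l - 2) / (l - 1) := by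
    have := B.m_eq (hA.trans hAB)
    rw [m] at this
    rw [this, one_div_div]
  have hβ0 : 0 < (l - 2) / (l - 1) := div_pos (by linarith) (by linarith)
  have hβ1 : (l - 2) / (l - 1) = 1 - 1 / (l - 1) := by
    rw [eq_sub_iff_add_eq, ← add_div, div_eq_one_iff_eq (by linarith)]; ring
  have hm : A.m₂ B = k / (k - 2 + (l - 2) / (l - 1)) := by
    rw [m₂, matrixM₂]
    apply le_antisymm
    · refine ciSup_le fun ⟨W, hW⟩ => ?_
      rw [A.rankQ_underlyingMatrix (by omega), hβ]
      by_cases hu : W = Finset.univ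
      · subst hu
        rw [rankCompl_univ, Finset.card_univ, Fintype.card_fin]
        apply le_of_eq
        congr 1
        push_cast
        ring
      · rw [A.rankCompl_of_ne_univ hu]
        have hW' : (2 : ℝ) ≤ W.card := by exact_mod_cast hW
        push_cast
        rw [add_sub_cancel_right, div_le_div_iff₀ (by linarith) (by linarith), hβ1]
        have h1 : 0 < 1 / (l - 1) := one_div_pos.2 (by linarith)
        have h2 : (l - 1) * (1 / (l - 1)) = 1 := mul_one_div_cancel (by linarith)
        have h3 : k * (1 / (l - 1)) ≤ l * (1 / (l - 1)) := mul_le_mul_of_nonneg_right hkl h1.le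
        have h4 : 2 * (1 + 1 / (l - 1)) ≤ W.card * (1 + 1 / (l - 1)) :=
          mul_le_mul_of_nonneg_right hW' (by linarith)
        nlinarith
    · refine le_ciSup_of_le (Set.finite_range _).bddAbove ⟨_, A.card_univ_le hA⟩ ?_
      rw [A.rankQ_underlyingMatrix (by omega), rankCompl_univ, Finset.card_univ, Fintype.card_fin,
        hβ]
      apply le_of_eq
      congr 1
      push_cast
      ring
  have hk0 : k ≠ 0 := by linarith
  have hl0 : l - 1 ≠ 0 := by linarith
  rw [hm, one_div_div]
  field_simp
  ring

end LinearEquation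

end Thresholds

/-! ### The limit, and the reduction to two colours -/

section Limit

open Filter Topology

theorem tendsto_polynomial_mul_exp_neg (P : Polynomial ℝ) {δ : ℝ} (hδ : 0 < δ) :
    Tendsto (fun y : ℝ => P.eval y * Real.exp (-(δ * y))) atTop (𝓝 0) := by
  have h1 := (P.comp (Polynomial.C δ⁻¹ * Polynomial.X)).tendsto_div_exp_atTop
  have h2 := h1.comp (tendsto_id.const_mul_atTop hδ)
  refine h2.congr fun y => ?_
  simp only [Function.comp_apply, id, Polynomial.eval_comp, Polynomial.eval_mul,
    Polynomial.eval_C, Polynomial.eval_X]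
  rw [inv_mul_cancel_left₀ hδ.ne', Real.exp_neg, div_eq_mul_inv]

theorem tendsto_first_moment_bound (H l D : ℕ) {δ : ℝ} (hδ : 0 < δ) :
    Tendsto (fun n : ℕ => ((⌈Real.log n⌉₊ : ℝ) + l + 1) *
        (H * (1 + 2 * (l * (⌈Real.log n⌉₊ + 3 * l + 6)) ^ l) ^ D * (n : ℝ) ^ (-δ)) +
      ((⌈Real.log n⌉₊ : ℝ) + l + 1) * (H * Real.exp (-⌈Real.log n⌉₊) * (n : ℝ) ^ (1 / 2 : ℝ)))
      atTop (𝓝 0) := by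
  -- `P` and `Q` come from bounding ⌈log n⌉ by log n + 1, which turns the constants l + 1 and 3l + 6
  -- into l + 2 and 3l + 7. In the second summand, exp(-⌈log n⌉) n^(1/2) is at most n^(-1/2).
  set P : Polynomial ℝ := (Polynomial.X + ((l : Polynomial ℝ) + 2)) *
    ((H : Polynomial ℝ) * (1 + 2 * ((l : Polynomial ℝ) *
      (Polynomial.X + (3 * (l : Polynomial ℝ) + 7))) ^ l) ^ D) with hP
  set Q : Polynomial ℝ := (Polynomial.X + ((l : Polynomial ℝ) + 2)) * (H : Polynomial ℝ) with hQ
  have hlog : Tendsto (fun n : ℕ => Real.log n) atTop atTop :=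
    Real.tendsto_log_atTop.comp tendsto_natCast_atTop_atTop
  have hlim : Tendsto (fun n : ℕ => P.eval (Real.log n) * Real.exp (-(δ * Real.log n)) +
      Q.eval (Real.log n) * Real.exp (-(1 / 2 * Real.log n))) atTop (𝓝 0) := by
    have h := ((tendsto_polynomial_mul_exp_neg P hδ).comp hlog).add
      ((tendsto_polynomial_mul_exp_neg Q (by norm_num : (0 : ℝ) < 1 / 2)).comp hlog)
    simpa using h
  refine squeeze_zero' (Eventually.of_forall fun n => by positivity) ?_ hlim
  filter_upwards [eventually_ge_atTop 1] with n hn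
  have hn0 : (0 : ℝ) < n := by exact_mod_cast hn
  have hy : 0 ≤ Real.log n := Real.log_natCast_nonneg n
  have hL1 : (⌈Real.log n⌉₊ : ℝ) ≤ Real.log n + 1 := (Nat.ceil_lt_add_one hy).le
  have hL2 : Real.log n ≤ ⌈Real.log n⌉₊ := Nat.le_ceil _
  have hPe : P.eval (Real.log n) = (Real.log n + 1 + l + 1) *
      (H * (1 + 2 * (l * (Real.log n + 1 + 3 * l + 6)) ^ l) ^ D) := by
    simp only [hP, Polynomial.eval_mul, Polynomial.eval_add, Polynomial.eval_X,
      Polynomial.eval_natCast, Polynomial.eval_pow, Polynomial.eval_one, Polynomial.eval_ofNat]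
    congr 1
    · ring
    · congr 6; ring
  have hQe : Q.eval (Real.log n) = (Real.log n + 1 + l + 1) * H := by
    simp only [hQ, Polynomial.eval_mul, Polynomial.eval_add, Polynomial.eval_X,
      Polynomial.eval_natCast, Polynomial.eval_ofNat]
    ring
  rw [hPe, hQe]
  refine add_le_add ?_ ?_
  · have h1 : (n : ℝ) ^ (-δ) = Real.exp (-(δ * Real.log n)) := by
      rw [Real.rpow_def_of_pos hn0]; congr 1; ring
    rw [h1, mul_assoc (_ + 1)]
    gcongr
  · have h1 : (n : ℝ) ^ (1 / 2 : ℝ) = Real.exp (1 / 2 * Real.log n) := by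
      rw [Real.rpow_def_of_pos hn0]; congr 1; ring
    have h2 : Real.exp (-⌈Real.log n⌉₊) * (n : ℝ) ^ (1 / 2 : ℝ) ≤
        Real.exp (-(1 / 2 * Real.log n)) := by
      rw [h1, ← Real.exp_add]
      apply Real.exp_le_exp.2
      linarith
    rw [mul_assoc (H : ℝ), mul_assoc (_ + 1) (H : ℝ)]
    gcongr

/-- Translate `χ` into a colouring that uses only `i₀` and `i₁`. Since a solution has at least one
entry, its colour is one of these two, and `i₀ ≠ i₁` recovers the value of `χ`. -/
theorem exists_solution_of_isRado {r : ℕ} {i₀ i₁ : Fin r} (hne : i₀ ≠ i₁)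
    {A : Fin r → LinearEquation} (hhom : ∀ i, (A i).IsHomogeneous)
    (hlen : ∀ i, 3 ≤ (A i).length) {S : Set ℤ} (hS : IsRado A S) (χ : ℤ → Bool) :
    ∃ τ : Bool, ∃ x : Fin (A (if τ then i₁ else i₀)).length → ℤ,
      Function.Injective x ∧ (∀ j, x j ∈ S) ∧
      ∑ j, (A (if τ then i₁ else i₀)).coeff j * x j = 0 ∧ ∀ j, χ (x j) = τ := by
  obtain ⟨i, x, hinj, hsol, hχ⟩ := hS fun s => if χ s then i₁ else i₀
  have hj : 0 < (A i).length := by have := hlen i; omega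
  set τ := χ (x ⟨0, hj⟩) with hτ
  have hi : (if τ then i₁ else i₀) = i := hχ ⟨0, hj⟩
  refine ⟨τ, ?_⟩
  have hcol : ∀ j, χ (x j) = τ := fun j => by
    have h := (hχ j).trans hi.symm
    generalize χ (x j) = b at h
    generalize τ = b' at h
    cases b <;> cases b' <;> simp [hne, hne.symm] at h ⊢
  clear_value τ
  subst hi
  refine ⟨fun j => x j, fun j j' h => hinj (Subtype.ext h), fun j => (x j).2, ?_, hcol⟩
  exact (show _ = _ from hsol).trans (hhom _)

end Limit

end RandomRado

theorem mainTheorem2 (r : ℕ) (hr : 2 ≤ r) (A : Fin r → RandomRado.LinearEquation)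
    (hhom : ∀ i, (A i).IsHomogeneous)
    (hirr : ∀ i, (A i).Irredundant)
    (hreg : ∀ i, (A i).PartitionRegular)
    (hlen : ∀ i, 3 ≤ (A i).length)
    (hanti : ∀ i j : Fin r, i ≤ j → (A j).m ≤ (A i).m) :
    ∃ c : ℝ, 0 < c ∧ ∀ p : ℕ → unitInterval,
      (∀ᶠ n : ℕ in Filter.atTop,
        (p n : ℝ) < c * (n : ℝ) ^
          (-(1 / RandomRado.LinearEquation.m₂ (A ⟨0, by omega⟩) (A ⟨1, by omega⟩)))) →
      Filter.Tendsto
        (fun n : ℕ => (RandomRado.randomSubset n (p n)).real {S | RandomRado.IsRado A S})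
        Filter.atTop (nhds 0) := by
  set i₀ : Fin r := ⟨0, by omega⟩ with hi₀
  set i₁ : Fin r := ⟨1, by omega⟩ with hi₁
  have hk : 3 ≤ (A i₀).length := hlen i₀
  have hkl : (A i₀).length ≤ (A i₁).length :=
    RandomRado.LinearEquation.length_le_of_m_le (hlen i₀) (hlen i₁)
      (hanti i₀ i₁ (by rw [hi₀, hi₁, Fin.mk_le_mk]; omega))
  have hθ := RandomRado.LinearEquation.one_div_m₂_eq hk hkl
  obtain ⟨H, hH⟩ := RandomRado.measure_unavoidable_le
    (K := fun τ => (A (if τ then i₁ else i₀)).length)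
    (a := fun τ => (A (if τ then i₁ else i₀)).coeff)
    (fun τ j => (A (if τ then i₁ else i₀)).coeff_ne_zero j) hk hkl
    (fun τ => by cases τ <;> simp)
  have hl0 : 0 < (2 * (A i₁).length * ((A i₁).length * (A i₁).length) : ℕ) := by
    have := hlen i₁
    positivity
  refine ⟨Real.exp (-1) / (2 * (A i₁).length * ((A i₁).length * (A i₁).length) : ℕ),
    div_pos (Real.exp_pos _) (by exact_mod_cast hl0), fun p hp => ?_⟩
  have hδ : (0 : ℝ) < 1 / ((A i₀).length * ((A i₁).length - 1)) := by
    have h1 : (3 : ℝ) ≤ (A i₀).length := by exact_mod_cast hk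
    have h2 : (3 : ℝ) ≤ (A i₁).length := by exact_mod_cast hlen i₁
    exact one_div_pos.2 (mul_pos (by linarith) (by linarith))
  refine squeeze_zero' (Filter.Eventually.of_forall fun n => MeasureTheory.measureReal_nonneg) ?_
    (RandomRado.tendsto_first_moment_bound H (A i₁).length (2 * (A i₁).length + 2) hδ)
  filter_upwards [hp, Filter.eventually_ge_atTop 1] with n hpn hn
  rw [hθ] at hpn
  have : MeasureTheory.IsProbabilityMeasure (RandomRado.randomSubset n (p n)) := by
    unfold RandomRado.randomSubset; infer_instance
  -- Chain length ⌈log n⌉ is long enough for exp(-L) to beat n^(1/2), and short enough that powers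
  -- of L do not matter against a negative power of n.
  refine (MeasureTheory.measureReal_mono ?_ (MeasureTheory.measure_ne_top _ _)).trans
    (hH n (p n) ⌈Real.log n⌉₊ hn hpn.le)
  intro S hS χ
  exact RandomRado.exists_solution_of_isRado (by simp [hi₀, hi₁]) hhom hlen hS χ
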